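/- Let $N\ge 2$. Let $\mathcal D(\mathbb R^N)$ be the Hilbert space completion of $C_c^\infty(\mathbb R^N)^N$ (real vector fields) with respect to the norm $$\|u\|_{\mathcal D}=\Big(\int_{\mathbb R^N}|u|^2\,dx+\int_{\mathbb R^N}|u|^2|x|^2\,dx+\int_{\mathbb R^N}|\nabla u|^2\,dx\Big)^{1/2},\qquad |\nabla u|^2=\sum_{j,k=1}^N\Big(\frac{\partial u_j}{\partial x_k}\Big)^2,$$ regarded as a space of fields $u\in L^2(\mathbb R^N)^N$ (identified when equal almost everywhere) with weak gradient $\nabla u\in L^2$. A field $u\in\mathcal D(\mathbb R^N)$ is called toroidal if its radial component $\frac{x}{|x|}\cdot u$ and its divergence $\operatorname{div}u=\sum_k \partial u_k/\partial x_k$ both vanish (almost everywhere). (i) Every toroidal $u\in\mathcal D(\mathbb R^N)$ satisfies $$\int_{\mathbb R^N}|\nabla u|^2\,dx\int_{\mathbb R^N}|u|^2|x|^2\,dx\ \ge\ C_{T,N}\Big(\int_{\mathbb R^N}|u|^2\,dx\Big)^2,\qquad C_{T,N}=\frac{(N+2)^2}{4},$$ and the constant is best possible: $C_{T,N}$ is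 the minimum of the quotient $\int|\nabla u|^2dx\int|u|^2|x|^2dx\,\big/\,\big(\int|u|^2dx\big)^2$ over all toroidal $u\in\mathcal D(\mathbb R^N)\setminus\{0\}$. (ii) For every $c>0$ and all vectors $c_1,\dots,c_N\in\mathbb R^N$ such that the matrix $(c_1,\dots,c_N)$ is antisymmetric, the smooth field $$u_0(x)=(c_1\cdot x,\ \dots,\ c_N\cdot x)\,e^{-c|x|^2}$$ is a toroidal field in $\mathcal D(\mathbb R^N)$ for which equality holds in (i); it satisfies the decay condition in (iii), and it is nonzero unless $c_1=\dots=c_N=0$. (iii) Conversely, if $u\in\mathcal D(\mathbb R^N)\setminus\{0\}$ is a toroidal field for which equality holds in (i), and if $$\lim_{R\to\infty}R^N\int_{\mathbb S^{N-1}}|u(R\sigma)|^2\,d\sigma=0$$ (as an essential limit, i.e. disregarding a null set of radii $R$), then $u$ coincides almost everywhere with a field $u_0$ of the form in (ii). -/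

import Mathlib

open MeasureTheory Filter Topology
open scoped ENNReal ContDiff Matrix

noncomputable section

namespace HUP

/-- `ℝ^N` with its Euclidean norm. -/
abbrev Sp (N : ℕ) : Type := EuclideanSpace ℝ (Fin N)

/-- The classical Jacobian matrix `(∂u_j/∂x_k)_{j,k}`. -/
def jac {N : ℕ} (u : Sp N → Sp N) (x : Sp N) : Matrix (Fin N) (Fin N) ℝ :=
  fun j k => (fderiv ℝ u x (EuclideanSpace.single k 1)) j

/-- The square of the `𝒟`-distance between the pairs `(u, G)` and `(v, H)` of a vector field and a
matrix field (playing the role of its gradient):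
`∫ |u - v|² dx + ∫ |u - v|² |x|² dx + ∫ |G - H|² dx ∈ [0, ∞]`. -/
def distSqD {N : ℕ} (u : Sp N → Sp N) (G : Sp N → Matrix (Fin N) (Fin N) ℝ)
    (v : Sp N → Sp N) (H : Sp N → Matrix (Fin N) (Fin N) ℝ) : ℝ≥0∞ :=
  (∫⁻ x, ‖u x - v x‖ₑ ^ 2) + (∫⁻ x, ‖u x - v x‖ₑ ^ 2 * ‖x‖ₑ ^ 2)
    + ∫⁻ x, ∑ j, ∑ k, ‖G x j k - H x j k‖ₑ ^ 2

/-- `MemD u G`: the field `u` belongs to the completion `𝒟(ℝ^N)` of `C_c^∞(ℝ^N)^N` for the norm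
`(∫ |u|² + ∫ |u|²|x|² + ∫ |∇u|²)^{1/2}`, and `G` is its gradient `∇u` (with `G x j k = ∂u_j/∂x_k`),
that is, `(u, G)` is the limit of `(φ n, ∇(φ n))` for a sequence of test fields `φ n`.
Such a `G` is the weak gradient of `u`; it is determined by `u` up to a null set. -/
def MemD {N : ℕ} (u : Sp N → Sp N) (G : Sp N → Matrix (Fin N) (Fin N) ℝ) : Prop :=
  AEStronglyMeasurable u volume ∧
  (∀ j k, AEStronglyMeasurable (fun x => G x j k) volume) ∧
  ∃ φ : ℕ → Sp N → Sp N,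
    (∀ n, ContDiff ℝ ∞ (φ n) ∧ HasCompactSupport (φ n)) ∧
    Tendsto (fun n => distSqD (φ n) (jac (φ n)) u G) atTop (𝓝 0)

/-- The radial component `u_R = σ · u`, where `σ = x/|x|`. -/
def radial {N : ℕ} (u : Sp N → Sp N) (x : Sp N) : ℝ :=
  inner ℝ (‖x‖⁻¹ • x) (u x)

/-- The field `u` with gradient `G` is toroidal: `u_R = div u = 0` (almost everywhere). -/
def IsToroidal {N : ℕ} (u : Sp N → Sp N) (G : Sp N → Matrix (Fin N) (Fin N) ℝ) : Prop :=
  (∀ᵐ x, radial u x = 0) ∧ (∀ᵐ x, (G x).trace = 0)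

/-- `∫ |u|² dx` -/
def massInt {N : ℕ} (u : Sp N → Sp N) : ℝ := ∫ x, ‖u x‖ ^ 2

/-- `∫ |u|² |x|² dx` -/
def momentInt {N : ℕ} (u : Sp N → Sp N) : ℝ := ∫ x, ‖u x‖ ^ 2 * ‖x‖ ^ 2

/-- `∫ |∇u|² dx = ∫ ∑_{j,k} (∂u_j/∂x_k)² dx`, where `G = ∇u` -/
def gradInt {N : ℕ} (G : Sp N → Matrix (Fin N) (Fin N) ℝ) : ℝ :=
  ∫ x, ∑ j, ∑ k, G x j k ^ 2

/-- `lim_{R → ∞} R^N ∫_{S^{N-1}} |u(Rσ)|² dσ = 0`, with `dσ` the surface measure of the unit sphere.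
The limit is an essential one (null sets of radii `R` are disregarded), so that the condition
does not depend on the values of `u` on null sets; the ordinary limit implies it. -/
def DecayCond {N : ℕ} (u : Sp N → Sp N) : Prop :=
  Tendsto (fun R : ℝ => ENNReal.ofReal (R ^ N) *
      ∫⁻ s : Metric.sphere (0 : Sp N) 1, ‖u (R • (s : Sp N))‖ₑ ^ 2 ∂(volume : Measure (Sp N)).toSphere)
    (atTop ⊓ ae volume) (𝓝 0)

/-- The field `(c₁ · x, …, c_N · x) e^{-c|x|²}`, where `c_j` is the `j`-th row of `A`. -/
def profile {N : ℕ} (A : Matrix (Fin N) (Fin N) ℝ) (c : ℝ) (x : Sp N) : Sp N :=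
  WithLp.toLp 2 (fun j => (∑ k, A j k * x k) * Real.exp (-c * ‖x‖ ^ 2))

end HUP

end

/-!
For real `b`, conjugating `∇` by `e^{b|x|²}` gives the twisted Jacobian `T_b u = ∇u + 2b u ⊗ x`,
whose entries are annihilation operators applied to the components of `u`. Their commutation
relations turn `∫ T_b u : (T_b u)ᵀ` into `∫ (div u - 2b x · u)² - 4b ∫ |u|²`, whose first term
vanishes for toroidal `u`, so that
`∫ |T_b u + (T_b u)ᵀ|² = 2 (∫ |∇u|² + 4b² ∫ |u|²|x|² - 2b (N + 2) ∫ |u|²)`.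
This is a nonnegative quadratic polynomial in `b`, so its discriminant is nonpositive, which is the
inequality. In the case of equality the polynomial has a root `b > 0`, for which `e^{b|x|²} u`
solves Killing's equation, hence is an affine map with antisymmetric linear part; being orthogonal
to `x`, it is linear. Conversely `T_b` maps `A x e^{-b|x|²}` to the antisymmetric field
`e^{-b|x|²} A`, so the extremal fields make the left-hand side vanish.
-/

noncomputable section

namespace HUP

/-! ### Convergence in `L²` -/

section Lp

variable {α : Type*} [MeasurableSpace α] {μ : Measure α}

theorem inner_toLp_eq_integral {f g : α → ℝ} (hf : MemLp f 2 μ) (hg : MemLp g 2 μ) :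
    inner ℝ (hf.toLp f) (hg.toLp g) = ∫ x, f x * g x ∂μ := by
  rw [L2.inner_def]
  refine integral_congr_ae ?_
  filter_upwards [hf.coeFn_toLp, hg.coeFn_toLp] with x hfx hgx
  rw [hfx, hgx, RCLike.inner_apply, conj_trivial, mul_comm]

theorem tendsto_integral_mul_of_tendsto_eLpNorm {ι : Type*} {l : Filter ι} {f g : α → ℝ}
    {φ : ι → α → ℝ} (hf : MemLp f 2 μ) (hg : MemLp g 2 μ) (hφ : ∀ n, MemLp (φ n) 2 μ)
    (hlim : Tendsto (fun n => eLpNorm (φ n - f) 2 μ) l (𝓝 0)) :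
    Tendsto (fun n => ∫ x, φ n x * g x ∂μ) l (𝓝 (∫ x, f x * g x ∂μ)) := by
  simp only [← inner_toLp_eq_integral hf hg, ← fun n => inner_toLp_eq_integral (hφ n) hg]
  exact ((Lp.tendsto_Lp_iff_tendsto_eLpNorm'' φ hφ f hf).2 hlim).inner tendsto_const_nhds

theorem integral_add_sq {f g : α → ℝ} (hf : MemLp f 2 μ) (hg : MemLp g 2 μ) :
    ∫ x, (f x + g x) ^ 2 ∂μ
      = (∫ x, f x ^ 2 ∂μ) + (∫ x, g x ^ 2 ∂μ) + 2 * ∫ x, f x * g x ∂μ := by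
  have hfg : Integrable (fun x => f x * g x) μ := hf.integrable_mul hg
  have hsq : Integrable (fun x => f x ^ 2 + g x ^ 2) μ := hf.integrable_sq.add hg.integrable_sq
  rw [← integral_const_mul, ← integral_add hf.integrable_sq hg.integrable_sq,
    ← integral_add hsq (hfg.const_mul 2)]
  congr 1 with x
  ring

theorem eLpNorm_two_eq_lintegral {E : Type*} [NormedAddCommGroup E] (f : α → E) :
    eLpNorm f 2 μ = (∫⁻ x, ‖f x‖ₑ ^ 2 ∂μ) ^ (1 / 2 : ℝ) := by
  rw [eLpNorm_eq_lintegral_rpow_enorm_toReal two_ne_zero ENNReal.ofNat_ne_top]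
  simp only [ENNReal.toReal_ofNat, ← ENNReal.rpow_natCast, Nat.cast_ofNat]

theorem tendsto_eLpNorm_two_iff {ι : Type*} {l : Filter ι} {E : Type*} [NormedAddCommGroup E]
    {F : ι → α → E} : Tendsto (fun n => eLpNorm (F n) 2 μ) l (𝓝 0)
      ↔ Tendsto (fun n => ∫⁻ x, ‖F n x‖ₑ ^ 2 ∂μ) l (𝓝 0) := by
  simp only [eLpNorm_two_eq_lintegral]
  refine ⟨fun h => ?_, fun h => ?_⟩
  · have hsq := h.ennrpow_const 2
    simpa only [← ENNReal.rpow_mul, one_div, inv_mul_cancel₀ (two_ne_zero (α := ℝ)),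
      ENNReal.rpow_one, ENNReal.zero_rpow_of_pos two_pos] using hsq
  · simpa using h.ennrpow_const (1 / 2)

theorem tendsto_eLpNorm_two_of_lintegral_le {ι : Type*} {l : Filter ι} {E : Type*}
    [NormedAddCommGroup E] {F : ι → α → E} {d : ι → ℝ≥0∞}
    (hF : ∀ n, ∫⁻ x, ‖F n x‖ₑ ^ 2 ∂μ ≤ d n) (hd : Tendsto d l (𝓝 0)) :
    Tendsto (fun n => eLpNorm (F n) 2 μ) l (𝓝 0) :=
  tendsto_eLpNorm_two_iff.2 <|
    tendsto_of_tendsto_of_tendsto_of_le_of_le tendsto_const_nhds hd (fun _ => zero_le) hF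

theorem tendsto_eLpNorm_two_smul {E : Type*} [NormedAddCommGroup E] [NormedSpace ℝ E]
    {a : ℕ → α → ℝ} {w : α → E} {C : ℝ} (ha : ∀ n, AEStronglyMeasurable (a n) μ)
    (hC : ∀ n x, ‖a n x‖ ≤ C) (hlim : ∀ x, Tendsto (fun n => a n x) atTop (𝓝 0))
    (hw : MemLp w 2 μ) : Tendsto (fun n => eLpNorm (fun x => a n x • w x) 2 μ) atTop (𝓝 0) := by
  have hdom : ∫⁻ x, (ENNReal.ofReal C * ‖w x‖ₑ) ^ 2 ∂μ ≠ ⊤ := by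
    have hsq := hw.eLpNorm_lt_top
    rw [eLpNorm_two_eq_lintegral, ENNReal.rpow_lt_top_iff_of_pos (by norm_num)] at hsq
    simp only [mul_pow]
    rw [lintegral_const_mul' _ _ (by finiteness)]
    finiteness
  rw [tendsto_eLpNorm_two_iff, ← lintegral_zero (μ := μ)]
  refine tendsto_lintegral_of_dominated_convergence' _
    (fun n => ((ha n).smul hw.1).enorm.pow_const 2) (fun n => .of_forall fun x => ?_) hdom
    (.of_forall fun x => ?_)
  · simp only [enorm_smul]
    gcongr
    rw [← ofReal_norm]
    exact ENNReal.ofReal_le_ofReal (hC n x)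
  · have hsmul := ((hlim x).smul_const (w x)).enorm
    rw [zero_smul, enorm_zero] at hsmul
    simpa using ENNReal.Tendsto.pow (n := 2) hsmul

theorem memLp_of_tendsto_eLpNorm {ι : Type*} {l : Filter ι} [l.NeBot] {E : Type*}
    [NormedAddCommGroup E] {p : ℝ≥0∞} {φ : ι → α → E} {f : α → E} (hf : AEStronglyMeasurable f μ)
    (hφ : ∀ n, MemLp (φ n) p μ) (h : Tendsto (fun n => eLpNorm (φ n - f) p μ) l (𝓝 0)) :
    MemLp f p μ := by
  obtain ⟨n, hn⟩ := (h.eventually (gt_mem_nhds ENNReal.zero_lt_top)).exists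
  simpa using (hφ n).sub ⟨(hφ n).1.sub hf, hn⟩

end Lp

/-! ### Test functions -/

/-- `φ` is a test function, i.e. belongs to `C_c^∞`: the fields of this kind generate `𝒟(ℝ^N)`, and
real-valued ones are used to express weak derivatives. -/
def IsTestFunction {E F : Type*} [NormedAddCommGroup E] [NormedSpace ℝ E] [NormedAddCommGroup F]
    [NormedSpace ℝ F] (φ : E → F) : Prop :=
  ContDiff ℝ ∞ φ ∧ HasCompactSupport φ

namespace IsTestFunction

variable {E F : Type*} [NormedAddCommGroup E] [NormedSpace ℝ E] [NormedAddCommGroup F]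
  [NormedSpace ℝ F]

theorem differentiable {φ : E → F} (h : IsTestFunction φ) : Differentiable ℝ φ :=
  h.1.differentiable (by simp)

theorem fderiv_apply {φ : E → F} (h : IsTestFunction φ) (v : E) :
    IsTestFunction fun x => fderiv ℝ φ x v :=
  ⟨(h.1.fderiv_right (by simp)).clm_apply contDiff_const, h.2.fderiv_apply ℝ v⟩

theorem contDiff_mul {φ ψ : E → ℝ} (h : IsTestFunction φ) (hψ : ContDiff ℝ ∞ ψ) :
    IsTestFunction fun x => ψ x * φ x :=
  ⟨hψ.mul h.1, h.2.mul_left⟩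

theorem add {φ ψ : E → F} (h : IsTestFunction φ) (hψ : IsTestFunction ψ) :
    IsTestFunction fun x => φ x + ψ x :=
  ⟨h.1.add hψ.1, h.2.add hψ.2⟩

theorem clm_comp {G : Type*} [NormedAddCommGroup G] [NormedSpace ℝ G] {φ : E → F}
    (h : IsTestFunction φ) (L : F →L[ℝ] G) : IsTestFunction fun x => L (φ x) :=
  ⟨L.contDiff.comp h.1, h.2.comp_left L.map_zero⟩

variable [MeasurableSpace E] [BorelSpace E] {μ : Measure E} [IsFiniteMeasureOnCompacts μ]

theorem memLp {φ : E → F} (h : IsTestFunction φ) (p : ℝ≥0∞) : MemLp φ p μ :=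
  h.1.continuous.memLp_of_hasCompactSupport h.2

theorem integrable {φ : E → F} (h : IsTestFunction φ) : Integrable φ μ :=
  h.1.continuous.integrable_of_hasCompactSupport h.2

theorem integral_fderiv_eq_zero [FiniteDimensional ℝ E] {ν : Measure E} [ν.IsAddHaarMeasure]
    {φ : E → ℝ} (h : IsTestFunction φ) (v : E) : ∫ x, fderiv ℝ φ x v ∂ν = 0 := by
  have ibp := integral_mul_fderiv_eq_neg_fderiv_mul_of_integrable (μ := ν)
    (f := fun _ : E => (1 : ℝ)) (g := φ) (v := v) (by simp)
    (by simpa using (h.fderiv_apply v).integrable) (by simpa using h.integrable)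
    (fun _ _ => differentiableAt_const _) (fun x _ => h.differentiable x)
  simpa using ibp

end IsTestFunction

variable {N : ℕ}

/-- The classical partial derivative `∂φ/∂x_k`; the argument `k` comes after `φ`, so that
`partialDeriv φ` is the gradient of `φ` as a family of functions. -/
def partialDeriv (φ : Sp N → ℝ) (k : Fin N) (x : Sp N) : ℝ :=
  fderiv ℝ φ x (EuclideanSpace.single k 1)

theorem contDiff_coord (k : Fin N) : ContDiff ℝ ∞ fun x : Sp N => x k :=
  (EuclideanSpace.proj (𝕜 := ℝ) k).contDiff

theorem partialDeriv_coord (k l : Fin N) (x : Sp N) :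
    partialDeriv (fun x => x k) l x = if k = l then 1 else 0 := by
  have h : HasFDerivAt (fun x : Sp N => x k) (EuclideanSpace.proj (𝕜 := ℝ) k : Sp N →L[ℝ] ℝ) x :=
    (EuclideanSpace.proj (𝕜 := ℝ) k : Sp N →L[ℝ] ℝ).hasFDerivAt
  simp [partialDeriv, h.fderiv]

theorem partialDeriv_add {φ ψ : Sp N → ℝ} {x : Sp N} (hφ : DifferentiableAt ℝ φ x)
    (hψ : DifferentiableAt ℝ ψ x) (k : Fin N) :
    partialDeriv (fun x => φ x + ψ x) k x = partialDeriv φ k x + partialDeriv ψ k x := by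
  simp only [partialDeriv, fderiv_fun_add hφ hψ, add_apply]

theorem partialDeriv_mul {φ ψ : Sp N → ℝ} {x : Sp N} (hφ : DifferentiableAt ℝ φ x)
    (hψ : DifferentiableAt ℝ ψ x) (k : Fin N) :
    partialDeriv (fun x => φ x * ψ x) k x
      = φ x * partialDeriv ψ k x + ψ x * partialDeriv φ k x := by
  simp only [partialDeriv, fderiv_fun_mul hφ hψ, add_apply, smul_apply, smul_eq_mul]

theorem partialDeriv_const_mul {φ : Sp N → ℝ} {x : Sp N} (hφ : DifferentiableAt ℝ φ x) (a : ℝ)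
    (k : Fin N) : partialDeriv (fun x => a * φ x) k x = a * partialDeriv φ k x := by
  simp only [partialDeriv, fderiv_const_mul hφ, smul_apply, smul_eq_mul]

theorem partialDeriv_comm {φ : Sp N → ℝ} (hφ : ContDiff ℝ ∞ φ) (k l : Fin N) (x : Sp N) :
    partialDeriv (partialDeriv φ l) k x = partialDeriv (partialDeriv φ k) l x := by
  have hd : DifferentiableAt ℝ (fderiv ℝ φ) x :=
    (hφ.fderiv_right (m := ∞) (by simp)).differentiable (by simp) x
  have hcomp (i j : Fin N) : partialDeriv (partialDeriv φ j) i x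
      = fderiv ℝ (fderiv ℝ φ) x (EuclideanSpace.single i 1) (EuclideanSpace.single j 1) := by
    unfold partialDeriv
    rw [fderiv_clm_apply hd (differentiableAt_const _)]
    simp
  rw [hcomp, hcomp]
  exact hφ.contDiffAt.isSymmSndFDerivAt (by simp [ENat.LEInfty.out]) _ _

protected theorem IsTestFunction.partialDeriv {φ : Sp N → ℝ} (h : IsTestFunction φ) (k : Fin N) :
    IsTestFunction (partialDeriv φ k) :=
  h.fderiv_apply _

theorem IsTestFunction.coord_mul {φ : Sp N → ℝ} (h : IsTestFunction φ) (k : Fin N) :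
    IsTestFunction fun x => x k * φ x :=
  h.contDiff_mul (contDiff_coord k)

theorem IsTestFunction.integral_partialDeriv_eq_zero {φ : Sp N → ℝ} (h : IsTestFunction φ)
    (k : Fin N) : ∫ x, partialDeriv φ k x = 0 :=
  h.integral_fderiv_eq_zero _

/-! ### The scalar weighted Sobolev space -/

/-- The scalar counterpart of `MemD`: `f` is the limit of test functions for the norm
`(∫ |f|² + ∫ |f|²|x|² + ∫ |∇f|²)^{1/2}`, and `g` is its gradient. -/
structure MemScalarD (f : Sp N → ℝ) (g : Fin N → Sp N → ℝ) : Prop where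
  memLp : MemLp f 2
  memLp_coord_mul : ∀ k, MemLp (fun x => x k * f x) 2
  memLp_grad : ∀ k, MemLp (g k) 2
  exists_approx : ∃ φ : ℕ → Sp N → ℝ, (∀ n, IsTestFunction (φ n)) ∧
    Tendsto (fun n => eLpNorm (φ n - f) 2 volume) atTop (𝓝 0) ∧
    (∀ k, Tendsto (fun n => eLpNorm ((fun x => x k * φ n x) - fun x => x k * f x) 2 volume)
      atTop (𝓝 0)) ∧
    ∀ k, Tendsto (fun n => eLpNorm (partialDeriv (φ n) k - g k) 2 volume) atTop (𝓝 0)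

/-- The operator `∂_k + 2b x_k`, i.e. the conjugate of `∂_k` by multiplication by `e^{b|x|²}`,
applied to a function `f` with gradient `g`. For `b > 0` it is the annihilation operator of a
harmonic oscillator, and replacing `b` by `-b` gives minus the creation operator. -/
def twistedDeriv (b : ℝ) (f : Sp N → ℝ) (g : Fin N → Sp N → ℝ) (k : Fin N) (x : Sp N) : ℝ :=
  g k x + 2 * b * (x k * f x)

protected theorem IsTestFunction.twistedDeriv {φ : Sp N → ℝ} (h : IsTestFunction φ) (b : ℝ)
    (k : Fin N) : IsTestFunction (twistedDeriv b φ (partialDeriv φ) k) :=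
  (h.partialDeriv k).add ((h.coord_mul k).contDiff_mul contDiff_const)

theorem twistedDeriv_commutator {φ : Sp N → ℝ} (hφ : ContDiff ℝ ∞ φ) (b c : ℝ) (k l : Fin N)
    (x : Sp N) :
    twistedDeriv b (twistedDeriv c φ (partialDeriv φ) l)
        (partialDeriv (twistedDeriv c φ (partialDeriv φ) l)) k x
      - twistedDeriv c (twistedDeriv b φ (partialDeriv φ) k)
        (partialDeriv (twistedDeriv b φ (partialDeriv φ) k)) l x
      = if k = l then 2 * (c - b) * φ x else 0 := by
  have hd : Differentiable ℝ φ := hφ.differentiable (by simp)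
  have hpartial (i : Fin N) : Differentiable ℝ (partialDeriv φ i) :=
    ((hφ.fderiv_right (m := ∞) (by simp)).clm_apply contDiff_const).differentiable (by simp)
  have hcoord (i : Fin N) : Differentiable ℝ fun x : Sp N => x i :=
    (contDiff_coord i).differentiable (by simp)
  have hexpand (a : ℝ) (i j : Fin N) : partialDeriv (twistedDeriv a φ (partialDeriv φ) j) i x
      = partialDeriv (partialDeriv φ j) i x
        + 2 * a * (x j * partialDeriv φ i x + φ x * if j = i then 1 else 0) := by
    have hmul : DifferentiableAt ℝ (fun x => x j * φ x) x := (hcoord j x).fun_mul (hd x)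
    unfold twistedDeriv
    rw [partialDeriv_add (hpartial j x) (hmul.const_mul _), partialDeriv_const_mul hmul,
      partialDeriv_mul (hcoord j x) (hd x), partialDeriv_coord]
  rw [twistedDeriv, hexpand, twistedDeriv.eq_def c (twistedDeriv b _ _ _), hexpand,
    partialDeriv_comm hφ, twistedDeriv, twistedDeriv]
  split_ifs <;> simp_all <;> ring

namespace MemScalarD

variable {f f' : Sp N → ℝ} {g g' : Fin N → Sp N → ℝ}

theorem memLp_twistedDeriv (h : MemScalarD f g) (b : ℝ) (k : Fin N) :
    MemLp (twistedDeriv b f g k) 2 :=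
  (h.memLp_grad k).add ((h.memLp_coord_mul k).const_mul (2 * b))

theorem exists_approx_twistedDeriv (h : MemScalarD f g) :
    ∃ φ : ℕ → Sp N → ℝ, (∀ n, IsTestFunction (φ n)) ∧
      Tendsto (fun n => eLpNorm (φ n - f) 2 volume) atTop (𝓝 0) ∧
      ∀ b k, Tendsto (fun n => eLpNorm
        (twistedDeriv b (φ n) (partialDeriv (φ n)) k - twistedDeriv b f g k) 2 volume)
        atTop (𝓝 0) := by
  obtain ⟨φ, hφ, hlim, hlim_coord, hlim_grad⟩ := h.exists_approx
  refine ⟨φ, hφ, hlim, fun b k => ?_⟩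
  have hbound := (hlim_grad k).add
    (ENNReal.Tendsto.const_mul (a := ‖2 * b‖ₑ) (hlim_coord k) (Or.inr enorm_ne_top))
  rw [mul_zero, add_zero] at hbound
  refine tendsto_of_tendsto_of_tendsto_of_le_of_le tendsto_const_nhds hbound (fun _ => zero_le)
    fun n => ?_
  have hsplit : twistedDeriv b (φ n) (partialDeriv (φ n)) k - twistedDeriv b f g k
      = (partialDeriv (φ n) k - g k)
        + (2 * b) • ((fun x => x k * φ n x) - fun x => x k * f x) := by
    ext x
    simp only [twistedDeriv, Pi.sub_apply, Pi.add_apply, Pi.smul_apply, smul_eq_mul]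
    ring
  rw [hsplit, ← eLpNorm_const_smul]
  exact eLpNorm_add_le (((hφ n).partialDeriv k).memLp 2 |>.sub (h.memLp_grad k)).1
    ((((hφ n).coord_mul k).memLp 2 |>.sub (h.memLp_coord_mul k)).const_smul _).1 one_le_two

theorem integral_twistedDeriv_mul (h : MemScalarD f g) {ψ : Sp N → ℝ} (hψ : IsTestFunction ψ)
    (b : ℝ) (k : Fin N) :
    ∫ x, twistedDeriv b f g k x * ψ x
      = -∫ x, f x * twistedDeriv (-b) ψ (partialDeriv ψ) k x := by
  obtain ⟨φ, hφ, hlim, hlim_twisted⟩ := h.exists_approx_twistedDeriv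
  have hψ' := (hψ.twistedDeriv (-b) k).memLp (μ := volume) 2
  have hleft := tendsto_integral_mul_of_tendsto_eLpNorm (h.memLp_twistedDeriv b k) (hψ.memLp 2)
    (fun n => ((hφ n).twistedDeriv b k).memLp 2) (hlim_twisted b k)
  have hright := tendsto_integral_mul_of_tendsto_eLpNorm h.memLp hψ' (fun n => (hφ n).memLp 2) hlim
  refine tendsto_nhds_unique hleft (hright.neg.congr fun n => ?_)
  have hdiv : (fun x => partialDeriv (fun x => φ n x * ψ x) k x)
      = fun x => twistedDeriv b (φ n) (partialDeriv (φ n)) k x * ψ x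
        + φ n x * twistedDeriv (-b) ψ (partialDeriv ψ) k x := by
    ext x
    rw [partialDeriv_mul ((hφ n).differentiable x) (hψ.differentiable x), twistedDeriv,
      twistedDeriv]
    ring
  have hzero := (hψ.contDiff_mul (hφ n).1).integral_partialDeriv_eq_zero k
  rw [hdiv] at hzero
  have hadd := integral_add ((((hφ n).twistedDeriv b k).memLp 2).integrable_mul (hψ.memLp 2))
    (((hφ n).memLp 2).integrable_mul hψ')
  simp only [Pi.mul_apply] at hadd
  linarith

theorem integral_twistedDeriv_mul_twistedDeriv_of_isTestFunction (h : MemScalarD f g)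
    {ψ : Sp N → ℝ} (hψ : IsTestFunction ψ) (b : ℝ) (k l : Fin N) :
    ∫ x, twistedDeriv b f g k x * twistedDeriv b ψ (partialDeriv ψ) l x
      = (∫ x, twistedDeriv (-b) f g l x * twistedDeriv (-b) ψ (partialDeriv ψ) k x)
        - if k = l then 4 * b * ∫ x, f x * ψ x else 0 := by
  have hint (a c : ℝ) (i j : Fin N) : Integrable fun x => f x *
      twistedDeriv a (twistedDeriv c ψ (partialDeriv ψ) j)
        (partialDeriv (twistedDeriv c ψ (partialDeriv ψ) j)) i x :=
    h.memLp.integrable_mul (((hψ.twistedDeriv c j).twistedDeriv a i).memLp 2)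
  rw [h.integral_twistedDeriv_mul (hψ.twistedDeriv b l),
    h.integral_twistedDeriv_mul (hψ.twistedDeriv (-b) k), neg_neg, ← sub_eq_zero,
    ← sub_add, sub_neg_eq_add, neg_add_eq_sub, ← integral_sub (hint _ _ _ _) (hint _ _ _ _)]
  simp only [← mul_sub, twistedDeriv_commutator hψ.1]
  rcases eq_or_ne l k with rfl | hkl
  · simp only [if_true, mul_left_comm (f _), integral_const_mul]
    ring
  · simp [hkl, hkl.symm]

theorem integral_twistedDeriv_mul_twistedDeriv (h : MemScalarD f g) (h' : MemScalarD f' g')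
    (b : ℝ) (k l : Fin N) :
    ∫ x, twistedDeriv b f g k x * twistedDeriv b f' g' l x
      = (∫ x, twistedDeriv (-b) f g l x * twistedDeriv (-b) f' g' k x)
        - if k = l then 4 * b * ∫ x, f x * f' x else 0 := by
  obtain ⟨φ, hφ, hlim, hlim_twisted⟩ := h'.exists_approx_twistedDeriv
  have htwisted (c : ℝ) (i j : Fin N) : Tendsto (fun n => ∫ x,
        twistedDeriv c f g i x * twistedDeriv c (φ n) (partialDeriv (φ n)) j x) atTop
      (𝓝 (∫ x, twistedDeriv c f g i x * twistedDeriv c f' g' j x)) := by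
    simpa only [mul_comm] using tendsto_integral_mul_of_tendsto_eLpNorm
      (h'.memLp_twistedDeriv c j) (h.memLp_twistedDeriv c i)
      (fun n => ((hφ n).twistedDeriv c j).memLp 2) (hlim_twisted c j)
  have hmul : Tendsto (fun n => ∫ x, f x * φ n x) atTop (𝓝 (∫ x, f x * f' x)) := by
    simpa only [mul_comm] using tendsto_integral_mul_of_tendsto_eLpNorm h'.memLp h.memLp
      (fun n => (hφ n).memLp 2) hlim
  refine tendsto_nhds_unique (htwisted b k l) ?_
  simp only [fun n => h.integral_twistedDeriv_mul_twistedDeriv_of_isTestFunction (hφ n) b k l]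
  refine (htwisted (-b) l k).sub ?_
  split_ifs
  exacts [hmul.const_mul _, tendsto_const_nhds]

theorem integral_twistedDeriv_sq (h : MemScalarD f g) (b : ℝ) (k : Fin N) :
    ∫ x, twistedDeriv b f g k x ^ 2
      = (∫ x, g k x ^ 2) + 4 * b ^ 2 * (∫ x, (x k * f x) ^ 2) - 2 * b * ∫ x, f x ^ 2 := by
  have hcomm := h.integral_twistedDeriv_mul_twistedDeriv h b k k
  simp only [if_true, ← pow_two] at hcomm
  have hparallelogram : (∫ x, twistedDeriv b f g k x ^ 2) + ∫ x, twistedDeriv (-b) f g k x ^ 2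
      = 2 * (∫ x, g k x ^ 2) + 8 * b ^ 2 * ∫ x, (x k * f x) ^ 2 := by
    rw [← integral_add (h.memLp_twistedDeriv b k).integrable_sq
      (h.memLp_twistedDeriv (-b) k).integrable_sq, ← integral_const_mul, ← integral_const_mul,
      ← integral_add ((h.memLp_grad k).integrable_sq.const_mul _)
        ((h.memLp_coord_mul k).integrable_sq.const_mul _)]
    congr 1 with x
    rw [twistedDeriv, twistedDeriv]
    ring
  linarith

end MemScalarD

/-! ### Components of fields in `𝒟` -/

theorem entry_le_sum_sum {m n : Type*} [Fintype m] [Fintype n] (M : Matrix m n ℝ≥0∞)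
    (j : m) (k : n) : M j k ≤ ∑ j, ∑ k, M j k :=
  (Finset.single_le_sum (fun _ _ => zero_le) (Finset.mem_univ k)).trans
    (Finset.single_le_sum (f := fun j => ∑ k, M j k) (fun _ _ => zero_le) (Finset.mem_univ j))

theorem enorm_apply_le (x : Sp N) (k : Fin N) : ‖x k‖ₑ ≤ ‖x‖ₑ := by
  simpa [enorm_le_iff_norm_le] using PiLp.norm_apply_le x k

theorem partialDeriv_apply_eq_jac {u : Sp N → Sp N} {x : Sp N} (hu : DifferentiableAt ℝ u x)
    (j k : Fin N) : partialDeriv (fun x => u x j) k x = jac u x j k := by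
  have h := (EuclideanSpace.proj (𝕜 := ℝ) j : Sp N →L[ℝ] ℝ).hasFDerivAt.comp x hu.hasFDerivAt
  exact congrArg (fun L : Sp N →L[ℝ] ℝ => L (EuclideanSpace.single k 1)) h.fderiv

namespace MemD

variable {u : Sp N → Sp N} {G : Sp N → Matrix (Fin N) (Fin N) ℝ}

theorem memScalarD (h : MemD u G) (j : Fin N) :
    MemScalarD (fun x => u x j) (fun k x => G x j k) := by
  obtain ⟨hu, hG, φ, hφ, hlim⟩ := h
  have hψ n : IsTestFunction fun x => φ n x j :=
    IsTestFunction.clm_comp (hφ n) (EuclideanSpace.proj (𝕜 := ℝ) j : Sp N →L[ℝ] ℝ)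
  have huj : AEStronglyMeasurable (fun x => u x j) volume :=
    (contDiff_coord j).continuous.comp_aestronglyMeasurable hu
  have hlim_field : Tendsto (fun n => eLpNorm ((fun x => φ n x j) - fun x => u x j) 2 volume)
      atTop (𝓝 0) := by
    refine tendsto_eLpNorm_two_of_lintegral_le (fun n => ?_) hlim
    rw [distSqD, add_assoc]
    refine le_trans (lintegral_mono fun x => ?_) le_self_add
    simp only [Pi.sub_apply]
    gcongr
    exact enorm_apply_le (φ n x - u x) j
  have hlim_coord (k : Fin N) : Tendsto (fun n => eLpNorm
      ((fun x => x k * φ n x j) - fun x => x k * u x j) 2 volume) atTop (𝓝 0) := by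
    refine tendsto_eLpNorm_two_of_lintegral_le (fun n => ?_) hlim
    rw [distSqD, add_right_comm]
    refine le_trans (lintegral_mono fun x => ?_) le_add_self
    simp only [Pi.sub_apply]
    rw [← mul_sub, enorm_mul, mul_pow, mul_comm]
    gcongr
    · exact enorm_apply_le (φ n x - u x) j
    · exact enorm_apply_le x k
  have hlim_grad (k : Fin N) : Tendsto (fun n => eLpNorm
      (partialDeriv (fun x => φ n x j) k - fun x => G x j k) 2 volume) atTop (𝓝 0) := by
    refine tendsto_eLpNorm_two_of_lintegral_le (fun n => ?_) hlim
    rw [distSqD]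
    refine le_trans (lintegral_mono fun x => ?_) le_add_self
    simp only [Pi.sub_apply]
    rw [partialDeriv_apply_eq_jac ((hφ n).1.differentiable (by simp) x)]
    exact entry_le_sum_sum (fun j k => ‖jac (φ n) x j k - G x j k‖ₑ ^ 2) j k
  exact
    { memLp := memLp_of_tendsto_eLpNorm huj (fun n => (hψ n).memLp 2) hlim_field
      memLp_coord_mul := fun k => memLp_of_tendsto_eLpNorm
        ((contDiff_coord k).continuous.aestronglyMeasurable.mul huj)
        (fun n => ((hψ n).coord_mul k).memLp 2) (hlim_coord k)
      memLp_grad := fun k => memLp_of_tendsto_eLpNorm (hG j k)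
        (fun n => ((hψ n).partialDeriv k).memLp 2) (hlim_grad k)
      exists_approx := ⟨_, hψ, hlim_field, hlim_coord, hlim_grad⟩ }

theorem massInt_eq (h : MemD u G) : massInt u = ∑ j, ∫ x, u x j ^ 2 := by
  simp only [massInt, EuclideanSpace.real_norm_sq_eq]
  exact integral_finsetSum _ fun j _ => (h.memScalarD j).memLp.integrable_sq

theorem momentInt_eq (h : MemD u G) : momentInt u = ∑ j, ∑ k, ∫ x, (x k * u x j) ^ 2 := by
  have hprod (x : Sp N) : ‖u x‖ ^ 2 * ‖x‖ ^ 2 = ∑ j, ∑ k, (x k * u x j) ^ 2 := by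
    simp only [EuclideanSpace.real_norm_sq_eq, Finset.sum_mul_sum, mul_pow, mul_comm (x _ ^ 2)]
  have hint (j k : Fin N) := ((h.memScalarD j).memLp_coord_mul k).integrable_sq
  simp only [momentInt, hprod]
  rw [integral_finsetSum _ fun j _ => integrable_finsetSum _ fun k _ => hint j k]
  exact Finset.sum_congr rfl fun j _ => integral_finsetSum _ fun k _ => hint j k

theorem gradInt_eq (h : MemD u G) : gradInt G = ∑ j, ∑ k, ∫ x, G x j k ^ 2 := by
  have hint (j k : Fin N) := ((h.memScalarD j).memLp_grad k).integrable_sq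
  rw [gradInt, integral_finsetSum _ fun j _ => integrable_finsetSum _ fun k _ => hint j k]
  exact Finset.sum_congr rfl fun j _ => integral_finsetSum _ fun k _ => hint j k

end MemD

/-! ### The energy identity -/

/-- The matrix `e^{-b|x|²} ∇(e^{b|x|²} u)`, where `G = ∇u`. -/
def twistedJac (b : ℝ) (u : Sp N → Sp N) (G : Sp N → Matrix (Fin N) (Fin N) ℝ) (x : Sp N) :
    Matrix (Fin N) (Fin N) ℝ :=
  fun j k => twistedDeriv b (fun x => u x j) (fun k x => G x j k) k x

variable {u : Sp N → Sp N} {G : Sp N → Matrix (Fin N) (Fin N) ℝ}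

theorem trace_twistedJac (b : ℝ) (u : Sp N → Sp N) (G : Sp N → Matrix (Fin N) (Fin N) ℝ)
    (x : Sp N) : (twistedJac b u G x).trace = (G x).trace + 2 * b * inner ℝ x (u x) := by
  simp only [Matrix.trace, Matrix.diag, twistedJac, twistedDeriv, Finset.sum_add_distrib,
    Finset.mul_sum, PiLp.inner_apply, RCLike.inner_apply, conj_trivial, mul_comm (x _)]

theorem inner_eq_zero_of_radial_eq_zero {x : Sp N} (h : radial u x = 0) : inner ℝ x (u x) = 0 := by
  rw [radial, real_inner_smul_left, mul_eq_zero, inv_eq_zero, norm_eq_zero] at h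
  exact h.elim (fun hx => by rw [hx, inner_zero_left]) id

theorem IsToroidal.trace_twistedJac_ae_eq_zero (h : IsToroidal u G) (b : ℝ) :
    ∀ᵐ x, (twistedJac b u G x).trace = 0 := by
  filter_upwards [h.1, h.2] with x hradial hdiv
  rw [trace_twistedJac, hdiv, inner_eq_zero_of_radial_eq_zero hradial, mul_zero, add_zero]

namespace MemD

theorem memLp_twistedJac (h : MemD u G) (b : ℝ) (j k : Fin N) :
    MemLp (fun x => twistedJac b u G x j k) 2 :=
  (h.memScalarD j).memLp_twistedDeriv b k

theorem sum_integral_twistedJac_sq (h : MemD u G) (b : ℝ) :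
    ∑ j, ∑ k, ∫ x, twistedJac b u G x j k ^ 2
      = gradInt G + 4 * b ^ 2 * momentInt u - 2 * b * N * massInt u := by
  simp only [twistedJac, fun j k => (h.memScalarD j).integral_twistedDeriv_sq b k, h.gradInt_eq,
    h.momentInt_eq, h.massInt_eq, Finset.sum_sub_distrib, Finset.sum_add_distrib,
    ← Finset.mul_sum, Finset.sum_const, Finset.card_univ, Fintype.card_fin, nsmul_eq_mul]
  ring

theorem sum_integral_twistedJac_mul_transpose (h : MemD u G) (b : ℝ) :
    ∑ j, ∑ k, ∫ x, twistedJac b u G x j k * twistedJac b u G x k j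
      = (∫ x, (twistedJac (-b) u G x).trace ^ 2) - 4 * b * massInt u := by
  have hint (j k : Fin N) : Integrable fun x =>
      twistedJac (-b) u G x j j * twistedJac (-b) u G x k k :=
    (h.memLp_twistedJac (-b) j j).integrable_mul (h.memLp_twistedJac (-b) k k)
  have htrace : ∫ x, (twistedJac (-b) u G x).trace ^ 2
      = ∑ j, ∑ k, ∫ x, twistedJac (-b) u G x j j * twistedJac (-b) u G x k k := by
    simp only [Matrix.trace, Matrix.diag, pow_two, Finset.sum_mul_sum]
    rw [integral_finsetSum _ fun j _ => integrable_finsetSum _ fun k _ => hint j k]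
    exact Finset.sum_congr rfl fun j _ => integral_finsetSum _ fun k _ => hint j k
  rw [htrace, h.massInt_eq, Finset.mul_sum, ← Finset.sum_sub_distrib]
  refine Finset.sum_congr rfl fun j _ => ?_
  simp only [twistedJac, fun k => (h.memScalarD j).integral_twistedDeriv_mul_twistedDeriv
    (h.memScalarD k) b k j, Finset.sum_sub_distrib, Finset.sum_ite_eq', Finset.mem_univ, if_true,
    pow_two]

theorem sum_integral_symm_twistedJac_sq (h : MemD u G) (b : ℝ) :
    ∑ j, ∑ k, ∫ x, (twistedJac b u G x j k + twistedJac b u G x k j) ^ 2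
      = 2 * (gradInt G + 4 * b ^ 2 * momentInt u - 2 * b * (N + 2) * massInt u
        + ∫ x, (twistedJac (-b) u G x).trace ^ 2) := by
  simp only [fun j k => integral_add_sq (h.memLp_twistedJac b j k) (h.memLp_twistedJac b k j),
    Finset.sum_add_distrib, ← Finset.mul_sum,
    h.sum_integral_twistedJac_mul_transpose]
  rw [Finset.sum_comm (f := fun j k => ∫ x, twistedJac b u G x k j ^ 2),
    h.sum_integral_twistedJac_sq]
  ring

theorem sum_integral_symm_twistedJac_sq_of_isToroidal (h : MemD u G) (ht : IsToroidal u G) (b : ℝ) :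
    ∑ j, ∑ k, ∫ x, (twistedJac b u G x j k + twistedJac b u G x k j) ^ 2
      = 2 * (gradInt G + 4 * b ^ 2 * momentInt u - 2 * b * (N + 2) * massInt u) := by
  have hdiv : ∫ x, (twistedJac (-b) u G x).trace ^ 2 = 0 := integral_eq_zero_of_ae <| by
    filter_upwards [ht.trace_twistedJac_ae_eq_zero (-b)] with x hx
    simp [hx]
  rw [h.sum_integral_symm_twistedJac_sq, hdiv, add_zero]

theorem energy_nonneg (h : MemD u G) (ht : IsToroidal u G) (b : ℝ) :
    0 ≤ gradInt G + 4 * b ^ 2 * momentInt u - 2 * b * (N + 2) * massInt u := by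
  have hsum := h.sum_integral_symm_twistedJac_sq_of_isToroidal ht b
  have hnonneg : 0 ≤ ∑ j, ∑ k, ∫ x, (twistedJac b u G x j k + twistedJac b u G x k j) ^ 2 :=
    Finset.sum_nonneg fun _ _ => Finset.sum_nonneg fun _ _ => integral_nonneg fun _ => sq_nonneg _
  linarith

theorem uncertainty (h : MemD u G) (ht : IsToroidal u G) :
    ((N : ℝ) + 2) ^ 2 / 4 * massInt u ^ 2 ≤ gradInt G * momentInt u := by
  have hdiscrim : discrim (4 * momentInt u) (-(2 * (N + 2) * massInt u)) (gradInt G) ≤ 0 :=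
    discrim_le_zero fun b => by linarith [h.energy_nonneg ht b]
  rw [discrim] at hdiscrim
  linarith

theorem symm_twistedJac_ae_eq_zero (h : MemD u G) (ht : IsToroidal u G) {b : ℝ}
    (hb : gradInt G + 4 * b ^ 2 * momentInt u - 2 * b * (N + 2) * massInt u = 0) (j k : Fin N) :
    ∀ᵐ x, twistedJac b u G x j k + twistedJac b u G x k j = 0 := by
  have hsum := h.sum_integral_symm_twistedJac_sq_of_isToroidal ht b
  rw [hb, mul_zero, Finset.sum_eq_zero_iff_of_nonneg fun _ _ =>
    Finset.sum_nonneg fun _ _ => integral_nonneg fun _ => sq_nonneg _] at hsum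
  have hjk := (Finset.sum_eq_zero_iff_of_nonneg fun _ _ => integral_nonneg fun _ => sq_nonneg _).1
    (hsum j (Finset.mem_univ j)) k (Finset.mem_univ k)
  have hint : Integrable fun x => (twistedJac b u G x j k + twistedJac b u G x k j) ^ 2 :=
    ((h.memLp_twistedJac b j k).add (h.memLp_twistedJac b k j)).integrable_sq
  rw [integral_eq_zero_iff_of_nonneg (fun _ => sq_nonneg _) hint] at hjk
  filter_upwards [hjk] with x hx
  exact pow_eq_zero_iff two_ne_zero |>.1 hx

end MemD

/-! ### Killing fields -/

section Killing

open scoped Convolution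

variable {E : Type*} [NormedAddCommGroup E] [InnerProductSpace ℝ E]

theorem fderiv_eq_fderiv_of_inner_fderiv_self_eq_zero {w : E → E} (hw : ContDiff ℝ 2 w)
    (h : ∀ x a, inner ℝ (fderiv ℝ w x a) a = 0) (x y : E) : fderiv ℝ w x = fderiv ℝ w y := by
  have hskew (x a b : E) : inner ℝ (fderiv ℝ w x a) b + inner ℝ (fderiv ℝ w x b) a = 0 := by
    have hab := h x (a + b)
    rw [map_add, inner_add_left, inner_add_right, inner_add_right, h x a, h x b] at hab
    linarith
  have hdiff : Differentiable ℝ (fderiv ℝ w) :=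
    (hw.fderiv_right (m := 1) (by norm_num)).differentiable (by simp)
  have hskew' (x c a b : E) : inner ℝ (fderiv ℝ (fderiv ℝ w) x c a) b
      + inner ℝ (fderiv ℝ (fderiv ℝ w) x c b) a = 0 := by
    have hderiv (a b : E) : HasFDerivAt (fun y => inner ℝ (fderiv ℝ w y a) b) _ x :=
      ((hdiff x).hasFDerivAt.clm_apply (hasFDerivAt_const a x)).inner ℝ (hasFDerivAt_const b x)
    have hzero := ((hderiv a b).add (hderiv b a)).unique
      ((hasFDerivAt_const (0 : ℝ) x).congr_of_eventuallyEq (.of_forall fun y => hskew y a b))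
    simpa using congrArg (fun L : E →L[ℝ] ℝ => L c) hzero
  have hsymm (x a b : E) : fderiv ℝ (fderiv ℝ w) x a b = fderiv ℝ (fderiv ℝ w) x b a :=
    hw.contDiffAt.isSymmSndFDerivAt (by simp) a b
  refine is_const_of_fderiv_eq_zero hdiff (fun x => ?_) x y
  ext c a
  -- A trilinear form symmetric in the first two and skew in the last two arguments vanishes.
  refine ext_inner_right ℝ fun b => ?_
  have hca := hskew' x c a b
  have hba := hskew' x b c a
  have hab := hskew' x a b c
  rw [hsymm x b c] at hba
  rw [hsymm x a b, hsymm x a c] at hab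
  simp only [zero_apply, inner_zero_left]
  linarith

theorem exists_affine_of_inner_fderiv_self_eq_zero {w : E → E} (hw : ContDiff ℝ 2 w)
    (h : ∀ x a, inner ℝ (fderiv ℝ w x a) a = 0) :
    ∃ (A : E →L[ℝ] E) (c : E), (∀ a, inner ℝ (A a) a = 0) ∧ ∀ x, w x = A x + c := by
  refine ⟨fderiv ℝ w 0, w 0, h 0, fun x => ?_⟩
  have hdiff : Differentiable ℝ w := hw.differentiable (by simp)
  have hconst := is_const_of_fderiv_eq_zero (𝕜 := ℝ) (f := fun x => w x - fderiv ℝ w 0 x)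
    (hdiff.sub (fderiv ℝ w 0).differentiable) (fun y => ?_) x 0
  · rw [map_zero, sub_zero] at hconst
    rw [← hconst, add_sub_cancel]
  · rw [fderiv_fun_sub (hdiff y) (fderiv ℝ w 0).differentiableAt, ContinuousLinearMap.fderiv,
      fderiv_eq_fderiv_of_inner_fderiv_self_eq_zero hw h y 0, sub_self]

variable [MeasurableSpace E]

/-- A weak Killing field: a locally integrable vector field `v` whose symmetrized distributional
gradient vanishes. By polarization it is enough to test with `⟪∂_a v, a⟫ = 0`. -/
structure IsWeakKilling (v : E → E) (μ : Measure E) : Prop where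
  locallyIntegrable : LocallyIntegrable v μ
  integral_inner_mul_fderiv : ∀ ψ : E → ℝ, IsTestFunction ψ → ∀ a,
    ∫ x, inner ℝ (v x) a * fderiv ℝ ψ x a ∂μ = 0

variable [BorelSpace E] [FiniteDimensional ℝ E] {μ : Measure E} [μ.IsAddHaarMeasure] {v : E → E}

theorem IsTestFunction.inner_fderiv_convolution {φ : E → ℝ} (hφ : IsTestFunction φ)
    (hv : LocallyIntegrable v μ) (x a b : E) :
    inner ℝ (fderiv ℝ (φ ⋆[ContinuousLinearMap.lsmul ℝ ℝ, μ] v) x a) b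
      = ∫ s, inner ℝ (v s) b * fderiv ℝ φ (x - s) a ∂μ := by
  have hφ' : Continuous (fderiv ℝ φ) := hφ.1.continuous_fderiv (by simp)
  have hint := ((hφ.2.fderiv ℝ).convolutionExists_left
    ((ContinuousLinearMap.lsmul ℝ ℝ : ℝ →L[ℝ] E →L[ℝ] E).precompL E) hφ' hv x).integrable_swap
  rw [(hφ.2.hasFDerivAt_convolution_left _ (hφ.1.of_le (by simp)) hv x).fderiv, convolution_eq_swap,
    ContinuousLinearMap.integral_apply hint, real_inner_comm,
    ← integral_inner (hint.apply_continuousLinearMap a)]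
  refine integral_congr_ae (.of_forall fun s => ?_)
  simp [ContinuousLinearMap.precompL_apply, inner_smul_right, real_inner_comm, mul_comm]

theorem IsWeakKilling.inner_fderiv_convolution_self (h : IsWeakKilling v μ) {φ : E → ℝ}
    (hφ : IsTestFunction φ) (x a : E) :
    inner ℝ (fderiv ℝ (φ ⋆[ContinuousLinearMap.lsmul ℝ ℝ, μ] v) x a) a = 0 := by
  have hψ : IsTestFunction fun s => φ (x - s) :=
    ⟨hφ.1.comp (contDiff_const.sub contDiff_id),
      hφ.2.comp_homeomorph (Homeomorph.subLeft x)⟩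
  have hderiv (s : E) : fderiv ℝ (fun s => φ (x - s)) s a = -fderiv ℝ φ (x - s) a := by
    have hcomp := (hφ.differentiable (x - s)).hasFDerivAt.comp s ((hasFDerivAt_id s).const_sub x)
    exact (congrArg (fun L : E →L[ℝ] ℝ => L a) hcomp.fderiv).trans (by simp)
  have hzero := h.integral_inner_mul_fderiv _ hψ a
  simp only [hderiv, mul_neg, integral_neg, neg_eq_zero] at hzero
  rw [hφ.inner_fderiv_convolution h.locallyIntegrable, hzero]

theorem exists_ae_tendsto_convolution (hv : LocallyIntegrable v μ) :
    ∃ φ : ℕ → E → ℝ, (∀ n, IsTestFunction (φ n)) ∧ ∀ᵐ x ∂μ, Tendsto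
      (fun n => (φ n ⋆[ContinuousLinearMap.lsmul ℝ ℝ, μ] v) x) atTop (𝓝 (v x)) := by
  let bump (n : ℕ) : ContDiffBump (0 : E) :=
    { rIn := 1 / ((n : ℝ) + 1)
      rOut := 2 * (1 / ((n : ℝ) + 1))
      rIn_pos := by positivity
      rIn_lt_rOut := lt_two_mul_self (by positivity) }
  refine ⟨fun n => (bump n).normed μ,
    fun n => ⟨(bump n).contDiff_normed, (bump n).hasCompactSupport_normed⟩,
    ContDiffBump.ae_convolution_tendsto_right_of_locallyIntegrable (K := 2) ?_
      (.of_forall fun n => le_rfl) hv⟩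
  simpa only [mul_zero] using tendsto_one_div_add_atTop_nhds_zero_nat.const_mul (2 : ℝ)

theorem exists_ae_eq_affine_of_ae_tendsto {A : ℕ → E →L[ℝ] E} {c : ℕ → E}
    (h : ∀ᵐ x ∂μ, Tendsto (fun n => A n x + c n) atTop (𝓝 (v x))) :
    ∃ (A' : E →L[ℝ] E) (c' : E), (∀ x, Tendsto (fun n => A n x) atTop (𝓝 (A' x))) ∧
      v =ᵐ[μ] fun x => A' x + c' := by
  obtain ⟨p, hp⟩ := h.exists
  have hconv (z : E) : ∃ y, Tendsto (fun n => A n z) atTop (𝓝 y) := by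
    obtain ⟨x, hx, hxz⟩ := (h.and
      ((measurePreserving_sub_right μ z).quasiMeasurePreserving.ae h)).exists
    exact ⟨_, (hx.sub hxz).congr fun n => by rw [map_sub]; abel⟩
  choose L hL using hconv
  let A' : E →ₗ[ℝ] E := linearMapOfTendsto L (fun n => (A n : E →ₗ[ℝ] E)) (tendsto_pi_nhds.2 hL)
  refine ⟨A'.toContinuousLinearMap, v p - L p, hL, ?_⟩
  filter_upwards [h] with x hx
  refine tendsto_nhds_unique hx (((hL x).add (hp.sub (hL p))).congr fun n => ?_)
  rw [add_sub_cancel_left]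

theorem IsWeakKilling.exists_ae_eq_affine (h : IsWeakKilling v μ) :
    ∃ (A : E →L[ℝ] E) (c : E), (∀ a, inner ℝ (A a) a = 0) ∧ v =ᵐ[μ] fun x => A x + c := by
  obtain ⟨φ, hφ, hlim⟩ := exists_ae_tendsto_convolution h.locallyIntegrable
  have haffine (n : ℕ) := exists_affine_of_inner_fderiv_self_eq_zero
    ((hφ n).2.contDiff_convolution_left _ ((hφ n).1.of_le ENat.LEInfty.out) h.locallyIntegrable)
    (h.inner_fderiv_convolution_self (hφ n))
  choose A c hA hAw using haffine
  simp only [hAw] at hlim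
  obtain ⟨A', c', hA', hv⟩ := exists_ae_eq_affine_of_ae_tendsto hlim
  exact ⟨A', c', fun a => tendsto_nhds_unique ((hA' a).inner tendsto_const_nhds)
    (tendsto_const_nhds.congr fun n => (hA n a).symm), hv⟩

end Killing

/-! ### Conjugation by Gaussians -/

theorem contDiff_exp_mul_norm_sq (b : ℝ) :
    ContDiff ℝ ∞ fun x : Sp N => Real.exp (b * ‖x‖ ^ 2) :=
  (contDiff_const.mul (contDiff_norm_sq ℝ)).exp

theorem partialDeriv_exp_mul_norm_sq (b : ℝ) (k : Fin N) (x : Sp N) :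
    partialDeriv (fun x => Real.exp (b * ‖x‖ ^ 2)) k x
      = 2 * b * (x k * Real.exp (b * ‖x‖ ^ 2)) := by
  have h := ((hasStrictFDerivAt_norm_sq x).hasFDerivAt.const_mul b).exp
  rw [partialDeriv, h.fderiv]
  simp only [smul_apply, innerSL_apply_apply, EuclideanSpace.inner_single_right,
    nsmul_eq_mul, smul_eq_mul, Nat.cast_ofNat, conj_trivial, one_mul]
  ring

theorem twistedDeriv_exp_mul (b : ℝ) {φ : Sp N → ℝ} {x : Sp N} (hφ : DifferentiableAt ℝ φ x)
    (k : Fin N) :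
    twistedDeriv b (fun x => Real.exp (-b * ‖x‖ ^ 2) * φ x)
        (partialDeriv fun x => Real.exp (-b * ‖x‖ ^ 2) * φ x) k x
      = Real.exp (-b * ‖x‖ ^ 2) * partialDeriv φ k x := by
  rw [twistedDeriv, partialDeriv_mul ((contDiff_exp_mul_norm_sq _).differentiable (by simp) x) hφ,
    partialDeriv_exp_mul_norm_sq]
  ring

/-! ### Antisymmetric matrices -/

theorem transpose_eq_neg_iff_inner_self_eq_zero {n : Type*} [Fintype n] [DecidableEq n]
    {A : Matrix n n ℝ} :
    Aᵀ = -A ↔ ∀ x, inner ℝ (Matrix.toEuclideanLin A x) x = 0 := by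
  have hinner (x : EuclideanSpace ℝ n) :
      inner ℝ (Matrix.toEuclideanLin A x) x = x.ofLp ⬝ᵥ A *ᵥ x.ofLp := by
    simp [EuclideanSpace.inner_eq_star_dotProduct]
  refine ⟨fun hA x => ?_, fun h => ?_⟩
  · have hneg : x.ofLp ⬝ᵥ A *ᵥ x.ofLp = -(x.ofLp ⬝ᵥ A *ᵥ x.ofLp) := by
      conv_lhs => rw [Matrix.dotProduct_mulVec, ← Matrix.mulVec_transpose, hA, dotProduct_comm,
        Matrix.neg_mulVec, dotProduct_neg]
    rw [hinner, self_eq_neg.1 hneg]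
  · have hquad (v : n → ℝ) : v ⬝ᵥ A *ᵥ v = 0 := by rw [← h (WithLp.toLp 2 v), hinner]
    have hdiag (j : n) : A j j = 0 := by simpa using hquad (Pi.single j 1)
    ext j k
    have hjk := hquad (Pi.single j 1 + Pi.single k 1)
    simp only [Matrix.mulVec_add, add_dotProduct, dotProduct_add, Matrix.mulVec_single_one,
      single_one_dotProduct, Matrix.col_apply, hdiag] at hjk
    rw [Matrix.transpose_apply, Matrix.neg_apply]
    linarith

theorem profile_eq_exp_smul (A : Matrix (Fin N) (Fin N) ℝ) (c : ℝ) (x : Sp N) :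
    profile A c x = Real.exp (-c * ‖x‖ ^ 2) • Matrix.toEuclideanLin A x := by
  ext j
  simp [profile, Matrix.toLpLin_apply, Matrix.mulVec, dotProduct, mul_comm]

/-! ### Rigidity -/

theorem fderiv_apply_eq_sum_partialDeriv (φ : Sp N → ℝ) (x a : Sp N) :
    fderiv ℝ φ x a = ∑ k, a k * partialDeriv φ k x := by
  conv_lhs => rw [← (EuclideanSpace.basisFun (Fin N) ℝ).sum_repr a]
  simp [partialDeriv]

namespace MemD

variable {u : Sp N → Sp N} {G : Sp N → Matrix (Fin N) (Fin N) ℝ}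

protected theorem memLp (h : MemD u G) : MemLp u 2 :=
  MemLp.of_eval_piLp fun j => (h.memScalarD j).memLp

theorem locallyIntegrable_exp_smul (h : MemD u G) (b : ℝ) :
    LocallyIntegrable fun x => Real.exp (b * ‖x‖ ^ 2) • u x :=
  locallyIntegrableOn_univ.1 <|
    ((h.memLp.locallyIntegrable one_le_two).locallyIntegrableOn _).continuousOn_smul
      isOpen_univ.isLocallyClosed (contDiff_exp_mul_norm_sq b).continuous.continuousOn

theorem integral_exp_mul_partialDeriv (h : MemD u G) (b : ℝ) {ψ : Sp N → ℝ}
    (hψ : IsTestFunction ψ) (j k : Fin N) :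
    ∫ x, Real.exp (b * ‖x‖ ^ 2) * u x j * partialDeriv ψ k x
      = -∫ x, twistedJac b u G x j k * (Real.exp (b * ‖x‖ ^ 2) * ψ x) := by
  have hadjoint := (h.memScalarD j).integral_twistedDeriv_mul
    (hψ.contDiff_mul (contDiff_exp_mul_norm_sq b)) b k
  have htwisted (x : Sp N) := twistedDeriv_exp_mul (-b) (hψ.differentiable x) k
  simp only [neg_neg] at htwisted
  simp only [twistedJac, hadjoint, htwisted, neg_neg]
  congr 1 with x
  ring

theorem integral_exp_mul_partialDeriv_add_swap (h : MemD u G) {b : ℝ} {j k : Fin N}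
    (hT : ∀ᵐ x, twistedJac b u G x j k + twistedJac b u G x k j = 0) {ψ : Sp N → ℝ}
    (hψ : IsTestFunction ψ) :
    (∫ x, Real.exp (b * ‖x‖ ^ 2) * u x j * partialDeriv ψ k x)
      + ∫ x, Real.exp (b * ‖x‖ ^ 2) * u x k * partialDeriv ψ j x = 0 := by
  have hint (i l : Fin N) :
      Integrable fun x => twistedJac b u G x i l * (Real.exp (b * ‖x‖ ^ 2) * ψ x) :=
    (h.memLp_twistedJac b i l).integrable_mul
      ((hψ.contDiff_mul (contDiff_exp_mul_norm_sq b)).memLp 2)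
  rw [h.integral_exp_mul_partialDeriv b hψ, h.integral_exp_mul_partialDeriv b hψ, ← neg_add,
    neg_eq_zero, ← integral_add (hint j k) (hint k j)]
  refine integral_eq_zero_of_ae ?_
  filter_upwards [hT] with x hx
  rw [← add_mul, hx, zero_mul, Pi.zero_apply]

theorem integral_inner_exp_smul_mul_fderiv (h : MemD u G) (b : ℝ) {ψ : Sp N → ℝ}
    (hψ : IsTestFunction ψ) (a : Sp N) :
    ∫ x, inner ℝ (Real.exp (b * ‖x‖ ^ 2) • u x) a * fderiv ℝ ψ x a
      = inner ℝ (Matrix.toEuclideanLin (Matrix.of fun j k =>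
        ∫ x, Real.exp (b * ‖x‖ ^ 2) * u x j * partialDeriv ψ k x) a) a := by
  have hexpand (x : Sp N) : inner ℝ (Real.exp (b * ‖x‖ ^ 2) • u x) a * fderiv ℝ ψ x a
      = ∑ j, ∑ k, a j * (a k * (Real.exp (b * ‖x‖ ^ 2) * u x j * partialDeriv ψ k x)) := by
    simp only [fderiv_apply_eq_sum_partialDeriv, PiLp.inner_apply, PiLp.smul_apply,
      RCLike.inner_apply, conj_trivial, smul_eq_mul, Finset.sum_mul_sum]
    congr! 2
    ring
  have hint (j k : Fin N) : Integrable fun x =>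
      a j * (a k * (Real.exp (b * ‖x‖ ^ 2) * u x j * partialDeriv ψ k x)) := by
    have hψ' := ((hψ.partialDeriv k).contDiff_mul (contDiff_exp_mul_norm_sq b)).memLp
      (μ := volume) 2
    refine (((((h.memScalarD j).memLp.integrable_mul hψ').const_mul (a k)).const_mul (a j))).congr
      (.of_forall fun x => ?_)
    simp only [Pi.mul_apply]
    ring
  simp only [hexpand]
  rw [integral_finsetSum _ fun j _ => integrable_finsetSum _ fun k _ => hint j k,
    PiLp.inner_apply]
  refine Finset.sum_congr rfl fun j _ => ?_
  rw [integral_finsetSum _ fun k _ => hint j k]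
  simp only [integral_const_mul, ← Finset.mul_sum, RCLike.inner_apply, conj_trivial,
    Matrix.toLpLin_apply, Matrix.mulVec, dotProduct, Matrix.of_apply, mul_comm (a _) (∫ _, _)]

theorem isWeakKilling_exp_smul (h : MemD u G) {b : ℝ}
    (hT : ∀ j k, ∀ᵐ x, twistedJac b u G x j k + twistedJac b u G x k j = 0) :
    IsWeakKilling (fun x => Real.exp (b * ‖x‖ ^ 2) • u x) volume where
  locallyIntegrable := h.locallyIntegrable_exp_smul b
  integral_inner_mul_fderiv ψ hψ a := by
    rw [h.integral_inner_exp_smul_mul_fderiv b hψ]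
    refine transpose_eq_neg_iff_inner_self_eq_zero.1 ?_ a
    ext j k
    exact eq_neg_of_add_eq_zero_left (h.integral_exp_mul_partialDeriv_add_swap (hT k j) hψ)

theorem exists_profile_of_energy_eq_zero (h : MemD u G) (ht : IsToroidal u G) {b : ℝ}
    (hb : gradInt G + 4 * b ^ 2 * momentInt u - 2 * b * (N + 2) * massInt u = 0) :
    ∃ A : Matrix (Fin N) (Fin N) ℝ, Aᵀ = -A ∧ u =ᵐ[volume] profile A b := by
  obtain ⟨L, c, hL, hu⟩ :=
    (h.isWeakKilling_exp_smul (h.symm_twistedJac_ae_eq_zero ht hb)).exists_ae_eq_affine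
  have hinner : (fun x : Sp N => inner ℝ x c) =ᵐ[volume] fun _ => 0 := by
    filter_upwards [hu, ht.1] with x hx hradial
    have hzero := congrArg (inner ℝ x) hx
    rwa [inner_smul_right, inner_eq_zero_of_radial_eq_zero hradial, mul_zero, inner_add_right,
      real_inner_comm, hL, zero_add, eq_comm] at hzero
  have hc : c = 0 := inner_self_eq_zero.1 <| congrFun
    (((continuous_id.inner continuous_const).ae_eq_iff_eq volume continuous_const).1 hinner) c
  refine ⟨Matrix.toEuclideanLin.symm L, ?_, ?_⟩
  · rw [transpose_eq_neg_iff_inner_self_eq_zero, LinearEquiv.apply_symm_apply]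
    exact hL
  · filter_upwards [hu] with x hx
    rw [profile_eq_exp_smul, LinearEquiv.apply_symm_apply, ContinuousLinearMap.coe_coe,
      ← add_zero (L x), ← hc, ← hx, smul_smul, ← Real.exp_add, neg_mul, neg_add_cancel,
      Real.exp_zero, one_smul]

theorem massInt_pos (h : MemD u G) (hu : ¬ u =ᵐ[volume] 0) : 0 < massInt u := by
  refine (integral_pos_iff_support_of_nonneg (fun _ => sq_nonneg _)
    (h.memLp.integrable_norm_pow two_ne_zero)).2 (pos_iff_ne_zero.2 fun hzero => hu ?_)
  filter_upwards [measure_eq_zero_iff_ae_notMem.1 hzero] with x hx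
  simpa using hx

theorem exists_profile_of_uncertainty_eq (h : MemD u G) (ht : IsToroidal u G)
    (hu : ¬ u =ᵐ[volume] 0)
    (heq : gradInt G * momentInt u = ((N : ℝ) + 2) ^ 2 / 4 * massInt u ^ 2) :
    ∃ (A : Matrix (Fin N) (Fin N) ℝ) (c : ℝ), Aᵀ = -A ∧ 0 < c ∧ u =ᵐ[volume] profile A c := by
  have hmass := h.massInt_pos hu
  have hmoment_nonneg : 0 ≤ momentInt u := integral_nonneg fun x => by positivity
  have hmoment : 0 < momentInt u := hmoment_nonneg.lt_of_ne fun hzero => by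
    rw [← hzero, mul_zero] at heq
    exact absurd heq (by positivity)
  -- The energy is a quadratic polynomial in `b`, minimal at this `b`, with minimum `0` by `heq`.
  have henergy : gradInt G + 4 * ((N + 2) * massInt u / (4 * momentInt u)) ^ 2 * momentInt u
      - 2 * ((N + 2) * massInt u / (4 * momentInt u)) * (N + 2) * massInt u = 0 := by
    field_simp
    linarith
  obtain ⟨A, hA, huA⟩ := h.exists_profile_of_energy_eq_zero ht henergy
  exact ⟨A, _, hA, by positivity, huA⟩

end MemD

/-! ### Smooth fields in `𝒟` -/

/-- `η` is a sequence of test functions used to truncate fields: the `η n` are uniformly bounded in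
`C¹`, and each point has a neighbourhood on which `η n` is eventually `1`. -/
structure IsCutoffSeq {E : Type*} [NormedAddCommGroup E] [NormedSpace ℝ E] (η : ℕ → E → ℝ) :
    Prop where
  isTestFunction : ∀ n, IsTestFunction (η n)
  norm_sub_one_le : ∀ n x, ‖η n x - 1‖ ≤ 1
  exists_norm_fderiv_le : ∃ C, ∀ n x, ‖fderiv ℝ (η n) x‖ ≤ C
  eventuallyEq_one : ∀ x, ∀ᶠ n in atTop, η n =ᶠ[𝓝 x] 1

theorem exists_isCutoffSeq (E : Type*) [NormedAddCommGroup E] [NormedSpace ℝ E]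
    [HasContDiffBump E] [FiniteDimensional ℝ E] : ∃ η : ℕ → E → ℝ, IsCutoffSeq η := by
  let χ : ContDiffBump (0 : E) := ⟨1, 2, one_pos, one_lt_two⟩
  have hχ : IsTestFunction χ := ⟨χ.contDiff, χ.hasCompactSupport⟩
  obtain ⟨C, hC⟩ := (hχ.2.fderiv ℝ).exists_bound_of_continuous (hχ.1.continuous_fderiv (by simp))
  refine ⟨fun n x => χ ((1 / ((n : ℝ) + 1)) • x), fun n => ⟨?_, ?_⟩, fun n x => ?_,
    ⟨C, fun n x => ?_⟩, fun x => ?_⟩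
  · exact hχ.1.comp (contDiff_const_smul _)
  · exact hχ.2.comp_smul (by positivity)
  · rw [Real.norm_eq_abs, abs_le]
    constructor <;> linarith [χ.nonneg' ((1 / ((n : ℝ) + 1)) • x),
      χ.le_one (x := (1 / ((n : ℝ) + 1)) • x)]
  · rw [fderiv_comp_smul, norm_smul, Real.norm_of_nonneg (by positivity)]
    refine (mul_le_of_le_one_left (norm_nonneg _) ?_).trans (hC _)
    rw [div_le_one (by positivity)]
    linarith [n.cast_nonneg (α := ℝ)]
  · have hlim : Tendsto (fun n : ℕ => (1 / ((n : ℝ) + 1)) • x) atTop (𝓝 0) := by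
      simpa only [zero_smul] using
        (tendsto_one_div_add_atTop_nhds_zero_nat (𝕜 := ℝ)).smul_const x
    filter_upwards [hlim.eventually (Metric.ball_mem_nhds 0 χ.rIn_pos)] with n hn
    have hscale : Continuous fun y : E => (1 / ((n : ℝ) + 1)) • y := continuous_const_smul _
    exact (χ.eventuallyEq_one_of_mem_ball hn).comp_tendsto hscale.continuousAt

namespace IsCutoffSeq

variable {E F : Type*} [NormedAddCommGroup E] [NormedSpace ℝ E] [MeasurableSpace E] [BorelSpace E]
  [NormedAddCommGroup F] [NormedSpace ℝ F] {μ : Measure E} {η : ℕ → E → ℝ} {w : E → F}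

theorem tendsto_eLpNorm_sub_one_smul (h : IsCutoffSeq η) (hw : MemLp w 2 μ) :
    Tendsto (fun n => eLpNorm (fun x => (η n x - 1) • w x) 2 μ) atTop (𝓝 0) := by
  refine tendsto_eLpNorm_two_smul (fun n => ?_) h.norm_sub_one_le (fun x => ?_) hw
  · exact ((h.isTestFunction n).1.continuous.sub continuous_const).aestronglyMeasurable
  · refine tendsto_const_nhds.congr' ?_
    filter_upwards [h.eventuallyEq_one x] with n hn
    rw [hn.eq_of_nhds, Pi.one_apply, sub_self]

theorem tendsto_eLpNorm_fderiv_smul (h : IsCutoffSeq η) (v : E) (hw : MemLp w 2 μ) :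
    Tendsto (fun n => eLpNorm (fun x => fderiv ℝ (η n) x v • w x) 2 μ) atTop (𝓝 0) := by
  obtain ⟨C, hC⟩ := h.exists_norm_fderiv_le
  refine tendsto_eLpNorm_two_smul (C := C * ‖v‖) (fun n => ?_) (fun n x => ?_) (fun x => ?_) hw
  · exact ((h.isTestFunction n).fderiv_apply v).1.continuous.aestronglyMeasurable
  · exact (fderiv ℝ (η n) x).le_of_opNorm_le (hC n x) v
  · refine tendsto_const_nhds.congr' ?_
    filter_upwards [h.eventuallyEq_one x] with n hn
    simp [hn.fderiv_eq, Pi.one_def]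

end IsCutoffSeq

theorem continuous_jac {u : Sp N → Sp N} (hu : ContDiff ℝ ∞ u) (j k : Fin N) :
    Continuous fun x => jac u x j k :=
  (contDiff_coord j).continuous.comp ((hu.continuous_fderiv (by simp)).clm_apply continuous_const)

theorem jac_smul {u : Sp N → Sp N} {η : Sp N → ℝ} {x : Sp N} (hη : DifferentiableAt ℝ η x)
    (hu : DifferentiableAt ℝ u x) (j k : Fin N) :
    jac (fun x => η x • u x) x j k = η x * jac u x j k + u x j * partialDeriv η k x := by
  rw [← partialDeriv_apply_eq_jac (hη.fun_smul hu), ← partialDeriv_apply_eq_jac hu]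
  exact partialDeriv_mul hη ((EuclideanSpace.proj (𝕜 := ℝ) j).differentiableAt.comp x hu) k

theorem IsCutoffSeq.tendsto_eLpNorm_jac_smul_sub {η : ℕ → Sp N → ℝ} (hη : IsCutoffSeq η)
    {u : Sp N → Sp N} (hu : ContDiff ℝ ∞ u) (hmass : MemLp u 2) {j k : Fin N}
    (hjac : MemLp (fun x => jac u x j k) 2) :
    Tendsto (fun n => eLpNorm (fun x => jac (fun x => η n x • u x) x j k - jac u x j k) 2 volume)
      atTop (𝓝 0) := by
  have hsum := (hη.tendsto_eLpNorm_sub_one_smul hjac).add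
    (hη.tendsto_eLpNorm_fderiv_smul (EuclideanSpace.single k 1) (hmass.eval_piLp j))
  rw [add_zero] at hsum
  refine tendsto_of_tendsto_of_tendsto_of_le_of_le tendsto_const_nhds hsum (fun _ => zero_le)
    fun n => ?_
  have hηn := hη.isTestFunction n
  refine (eLpNorm_congr_ae (.of_forall fun x => ?_)).trans_le (eLpNorm_add_le
    ((hηn.1.continuous.sub continuous_const).aestronglyMeasurable.smul hjac.1)
    ((hηn.fderiv_apply _).1.continuous.aestronglyMeasurable.smul (hmass.eval_piLp j).1) one_le_two)
  simp only [jac_smul (hηn.differentiable x) (hu.differentiable (by simp) x), partialDeriv,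
    Pi.add_apply, smul_eq_mul]
  ring

theorem distSqD_smul_eq {u : Sp N → Sp N} (hu : ContDiff ℝ ∞ u) {η : Sp N → ℝ}
    (hη : ContDiff ℝ ∞ η) : distSqD (fun x => η x • u x) (jac fun x => η x • u x) u (jac u)
      = (∫⁻ x, ‖(η x - 1) • u x‖ₑ ^ 2) + (∫⁻ x, ‖(η x - 1) • (‖x‖ • u x)‖ₑ ^ 2)
        + ∑ j, ∑ k, ∫⁻ x, ‖jac (fun x => η x • u x) x j k - jac u x j k‖ₑ ^ 2 := by
  have hmeas (j k : Fin N) : Measurable fun x =>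
      ‖jac (fun x => η x • u x) x j k - jac u x j k‖ₑ ^ 2 :=
    ((continuous_jac (hη.smul hu) j k).sub (continuous_jac hu j k)).enorm.measurable.pow_const 2
  have hsub (x : Sp N) : (η x - 1) • u x = η x • u x - u x := by rw [sub_smul, one_smul]
  have hmoment (x : Sp N) :
      ‖(η x - 1) • (‖x‖ • u x)‖ₑ ^ 2 = ‖η x • u x - u x‖ₑ ^ 2 * ‖x‖ₑ ^ 2 := by
    rw [smul_comm, enorm_smul, enorm_norm, hsub, mul_pow, mul_comm]
  rw [distSqD, lintegral_finsetSum _ fun j _ => Finset.measurable_fun_sum _ fun k _ => hmeas j k]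
  simp only [lintegral_finsetSum _ fun k _ => hmeas _ k, hsub, hmoment]

theorem memD_of_contDiff {u : Sp N → Sp N} (hu : ContDiff ℝ ∞ u) (hmass : MemLp u 2)
    (hmoment : MemLp (fun x => ‖x‖ • u x) 2) (hjac : ∀ j k, MemLp (fun x => jac u x j k) 2) :
    MemD u (jac u) := by
  obtain ⟨η, hη⟩ := exists_isCutoffSeq (Sp N)
  have hηC (n : ℕ) := (hη.isTestFunction n).1
  refine ⟨hmass.1, fun j k => (hjac j k).1, fun n x => η n x • u x,
    fun n => ⟨(hηC n).smul hu, (hη.isTestFunction n).2.smul_right⟩, ?_⟩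
  have hlim {w : Sp N → Sp N} (hw : MemLp w 2) :=
    tendsto_eLpNorm_two_iff.1 (hη.tendsto_eLpNorm_sub_one_smul hw)
  have hlim_jac (j k : Fin N) :=
    tendsto_eLpNorm_two_iff.1 (hη.tendsto_eLpNorm_jac_smul_sub hu hmass (hjac j k))
  simpa only [distSqD_smul_eq hu (hηC _), add_zero, Finset.sum_const_zero] using
    ((hlim hmass).add (hlim hmoment)).add
      (tendsto_finsetSum _ fun j _ => tendsto_finsetSum _ fun k _ => hlim_jac j k)

/-! ### Extremal fields -/

theorem integrable_exp_neg_mul_norm_sq {V : Type*} [NormedAddCommGroup V] [InnerProductSpace ℝ V]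
    [FiniteDimensional ℝ V] [MeasurableSpace V] [BorelSpace V] {c : ℝ} (hc : 0 < c) :
    Integrable fun x : V => Real.exp (-c * ‖x‖ ^ 2) := by
  refine (GaussianFourier.integrable_cexp_neg_mul_sq_norm_add (V := V) (b := c)
    (by simpa using hc) 0 0).norm.congr (.of_forall fun x => ?_)
  simp [Complex.norm_exp, ← Complex.ofReal_pow]

theorem memLp_exp_neg_mul_norm_pow {V : Type*} [NormedAddCommGroup V] [InnerProductSpace ℝ V]
    [FiniteDimensional ℝ V] [MeasurableSpace V] [BorelSpace V] {c : ℝ} (hc : 0 < c) (k : ℕ) :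
    MemLp (fun x : V => Real.exp (-c * ‖x‖ ^ 2) * ‖x‖ ^ k) 2 := by
  have hcont : Continuous fun x : V => Real.exp (-c * ‖x‖ ^ 2) * ‖x‖ ^ k := by fun_prop
  rw [memLp_two_iff_integrable_sq hcont.aestronglyMeasurable]
  refine ((integrable_exp_neg_mul_norm_sq hc).const_mul (k.factorial / c ^ k)).mono'
    (hcont.pow 2).aestronglyMeasurable (.of_forall fun x => ?_)
  have hpow : ‖x‖ ^ (2 * k) ≤ k.factorial / c ^ k * Real.exp (c * ‖x‖ ^ 2) := by
    have h := Real.pow_div_factorial_le_exp (c * ‖x‖ ^ 2) (by positivity) k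
    rw [div_le_iff₀ (by positivity), mul_pow, ← pow_mul] at h
    rw [div_mul_eq_mul_div, le_div_iff₀ (by positivity)]
    linarith
  calc ‖(Real.exp (-c * ‖x‖ ^ 2) * ‖x‖ ^ k) ^ 2‖
      = Real.exp (-(2 * c) * ‖x‖ ^ 2) * ‖x‖ ^ (2 * k) := by
        rw [Real.norm_of_nonneg (sq_nonneg _), mul_pow, ← Real.exp_nat_mul, ← pow_mul, mul_comm k]
        push_cast
        ring_nf
    _ ≤ Real.exp (-(2 * c) * ‖x‖ ^ 2) * (k.factorial / c ^ k * Real.exp (c * ‖x‖ ^ 2)) := by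
        gcongr
    _ = k.factorial / c ^ k * Real.exp (-c * ‖x‖ ^ 2) := by
        rw [mul_left_comm, ← Real.exp_add]
        ring_nf

theorem contDiff_profile (A : Matrix (Fin N) (Fin N) ℝ) (c : ℝ) : ContDiff ℝ ∞ (profile A c) := by
  simp only [funext (profile_eq_exp_smul A c)]
  exact (contDiff_exp_mul_norm_sq _).smul (Matrix.toEuclideanLin A).toContinuousLinearMap.contDiff

theorem exists_norm_profile_le (A : Matrix (Fin N) (Fin N) ℝ) (c : ℝ) :
    ∃ C, ∀ x, ‖profile A c x‖ ≤ C * (Real.exp (-c * ‖x‖ ^ 2) * ‖x‖) := by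
  refine ⟨‖(Matrix.toEuclideanLin A).toContinuousLinearMap‖, fun x => ?_⟩
  rw [profile_eq_exp_smul, norm_smul, Real.norm_of_nonneg (Real.exp_pos _).le, mul_left_comm]
  gcongr
  exact (Matrix.toEuclideanLin A).toContinuousLinearMap.le_opNorm x

theorem memLp_profile (A : Matrix (Fin N) (Fin N) ℝ) {c : ℝ} (hc : 0 < c) :
    MemLp (profile A c) 2 := by
  obtain ⟨C, hC⟩ := exists_norm_profile_le A c
  refine (memLp_exp_neg_mul_norm_pow hc 1).of_le_mul (c := C)
    (contDiff_profile A c).continuous.aestronglyMeasurable (.of_forall fun x => ?_)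
  rw [pow_one, Real.norm_of_nonneg (by positivity)]
  exact hC x

theorem memLp_norm_smul_profile (A : Matrix (Fin N) (Fin N) ℝ) {c : ℝ} (hc : 0 < c) :
    MemLp (fun x => ‖x‖ • profile A c x) 2 := by
  obtain ⟨C, hC⟩ := exists_norm_profile_le A c
  refine (memLp_exp_neg_mul_norm_pow hc 2).of_le_mul (c := C)
    (continuous_norm.smul (contDiff_profile A c).continuous).aestronglyMeasurable
    (.of_forall fun x => ?_)
  rw [norm_smul, norm_norm, Real.norm_of_nonneg (by positivity)]
  linarith [mul_le_mul_of_nonneg_left (hC x) (norm_nonneg x)]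

theorem twistedJac_profile (A : Matrix (Fin N) (Fin N) ℝ) (c : ℝ) (x : Sp N) :
    twistedJac c (profile A c) (jac (profile A c)) x = Real.exp (-c * ‖x‖ ^ 2) • A := by
  ext j k
  let ℓ : Sp N →L[ℝ] ℝ :=
    EuclideanSpace.proj j ∘L (Matrix.toEuclideanLin A).toContinuousLinearMap
  have hℓ : partialDeriv ℓ k x = A j k := by
    simp [ℓ, partialDeriv, Matrix.toLpLin_apply]
  have happly : (fun x => profile A c x j) = fun x => Real.exp (-c * ‖x‖ ^ 2) * ℓ x := by
    ext x
    simp [profile_eq_exp_smul, ℓ]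
  have hjac (x : Sp N) : (fun k => jac (profile A c) x j k)
      = fun k => partialDeriv (fun x => profile A c x j) k x := by
    ext k
    exact (partialDeriv_apply_eq_jac ((contDiff_profile A c).differentiable (by simp) x) j k).symm
  have htwisted := twistedDeriv_exp_mul c ℓ.differentiableAt k (x := x)
  rw [hℓ, ← happly] at htwisted
  simpa [twistedJac, twistedDeriv, funext_iff.1 (hjac x)] using htwisted

theorem memLp_jac_profile (A : Matrix (Fin N) (Fin N) ℝ) {c : ℝ} (hc : 0 < c) (j k : Fin N) :
    MemLp (fun x => jac (profile A c) x j k) 2 := by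
  have hjac (x : Sp N) : jac (profile A c) x j k
      = A j k * (Real.exp (-c * ‖x‖ ^ 2) * ‖x‖ ^ 0) - 2 * c * (x k * profile A c x j) := by
    have h := congrFun₂ (twistedJac_profile A c x) j k
    simp only [twistedJac, twistedDeriv, Matrix.smul_apply, smul_eq_mul] at h
    linarith
  have hcoord : MemLp (fun x => x k * profile A c x j) 2 := by
    refine (memLp_norm_smul_profile A hc).mono ((contDiff_coord k).continuous.mul
      ((contDiff_coord j).comp (contDiff_profile A c)).continuous).aestronglyMeasurable
      (.of_forall fun x => ?_)
    rw [norm_mul, norm_smul, norm_norm]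
    gcongr <;> exact PiLp.norm_apply_le _ _
  simp only [hjac]
  exact ((memLp_exp_neg_mul_norm_pow hc 0).const_mul _).sub (hcoord.const_mul _)

theorem memD_profile (A : Matrix (Fin N) (Fin N) ℝ) {c : ℝ} (hc : 0 < c) :
    MemD (profile A c) (jac (profile A c)) :=
  memD_of_contDiff (contDiff_profile A c) (memLp_profile A hc) (memLp_norm_smul_profile A hc)
    (memLp_jac_profile A hc)

theorem isToroidal_profile {A : Matrix (Fin N) (Fin N) ℝ} (hA : Aᵀ = -A) (c : ℝ) :
    IsToroidal (profile A c) (jac (profile A c)) := by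
  have hinner (x : Sp N) : inner ℝ x (profile A c x) = 0 := by
    rw [profile_eq_exp_smul, real_inner_smul_right, real_inner_comm,
      transpose_eq_neg_iff_inner_self_eq_zero.1 hA, mul_zero]
  have htrace : A.trace = 0 := by
    rw [← self_eq_neg, ← Matrix.trace_neg, ← hA, Matrix.trace_transpose]
  refine ⟨.of_forall fun x => ?_, .of_forall fun x => ?_⟩
  · rw [radial, real_inner_smul_left, hinner, mul_zero]
  · have h := congrArg Matrix.trace (twistedJac_profile A c x)
    rwa [trace_twistedJac, hinner, mul_zero, add_zero, Matrix.trace_smul, htrace, smul_zero] at h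

theorem decayCond_of_norm_sq_le {u : Sp N → Sp N} {g : ℝ → ℝ} (hu : ∀ x, ‖u x‖ ^ 2 ≤ g ‖x‖)
    (hg : Tendsto (fun R => R ^ N * g R) atTop (𝓝 0)) : DecayCond u := by
  refine Tendsto.mono_left ?_ inf_le_left
  set σ := (volume : Measure (Sp N)).toSphere
  have hlim : Tendsto (fun R => ENNReal.ofReal (R ^ N * g R) * σ Set.univ) atTop (𝓝 0) := by
    simpa using ENNReal.Tendsto.mul_const (ENNReal.tendsto_ofReal hg) (.inr (measure_ne_top σ _))
  refine tendsto_of_tendsto_of_tendsto_of_le_of_le' tendsto_const_nhds hlim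
    (.of_forall fun _ => zero_le) ?_
  filter_upwards [eventually_ge_atTop 0] with R hR
  rw [ENNReal.ofReal_mul (by positivity), mul_assoc, ← lintegral_const]
  gcongr with s
  have hs := hu (R • (s : Sp N))
  rw [norm_smul, norm_eq_of_mem_sphere, mul_one, Real.norm_of_nonneg hR] at hs
  rw [← ofReal_norm, ← ENNReal.ofReal_pow (norm_nonneg _)]
  exact ENNReal.ofReal_le_ofReal hs

theorem decayCond_profile (A : Matrix (Fin N) (Fin N) ℝ) {c : ℝ} (hc : 0 < c) :
    DecayCond (profile A c) := by
  obtain ⟨C, hC⟩ := exists_norm_profile_le A c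
  refine decayCond_of_norm_sq_le (g := fun R => (C * (Real.exp (-c * R ^ 2) * R)) ^ 2)
    (fun x => pow_le_pow_left₀ (norm_nonneg _) (hC x) 2) ?_
  have hexp : Tendsto (fun R : ℝ => Real.exp (-(1 / 2) * R)) atTop (𝓝 0) :=
    Real.tendsto_exp_atBot.comp (tendsto_id.const_mul_atTop_of_neg (by norm_num))
  have hlim := ((rpow_mul_exp_neg_mul_sq_isLittleO_exp_neg (b := 2 * c) (by positivity)
    ((N + 2 : ℕ) : ℝ)).trans_tendsto hexp).const_mul (C ^ 2)
  rw [mul_zero] at hlim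
  refine hlim.congr fun R => ?_
  rw [Real.rpow_natCast, mul_pow, mul_pow, ← Real.exp_nat_mul]
  push_cast
  ring_nf

theorem profile_not_ae_eq_zero {A : Matrix (Fin N) (Fin N) ℝ} (hA : A ≠ 0) (c : ℝ) :
    ¬ profile A c =ᵐ[volume] 0 := fun h => by
  have hzero := ((contDiff_profile A c).continuous.ae_eq_iff_eq volume continuous_zero).1 h
  refine hA (Matrix.toEuclideanLin.map_eq_zero_iff.1 (LinearMap.ext fun x => ?_))
  have hx := congrFun hzero x
  rw [profile_eq_exp_smul] at hx
  exact (smul_eq_zero.1 hx).resolve_left (Real.exp_pos _).ne'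

theorem energy_profile_eq_zero {A : Matrix (Fin N) (Fin N) ℝ} {c : ℝ} (hA : Aᵀ = -A)
    (hc : 0 < c) : gradInt (jac (profile A c)) + 4 * c ^ 2 * momentInt (profile A c)
      - 2 * c * (N + 2) * massInt (profile A c) = 0 := by
  have hsymm (x : Sp N) (j k : Fin N) : twistedJac c (profile A c) (jac (profile A c)) x j k
      + twistedJac c (profile A c) (jac (profile A c)) x k j = 0 := by
    have hjk : A k j = -A j k := congrFun₂ hA j k
    simp [twistedJac_profile, hjk]
  have hsum := (memD_profile A hc).sum_integral_symm_twistedJac_sq_of_isToroidal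
    (isToroidal_profile hA c) c
  simp only [hsymm] at hsum
  simpa using hsum

theorem uncertainty_eq_profile {A : Matrix (Fin N) (Fin N) ℝ} {c : ℝ} (hA : Aᵀ = -A)
    (hc : 0 < c) : gradInt (jac (profile A c)) * momentInt (profile A c)
      = ((N : ℝ) + 2) ^ 2 / 4 * massInt (profile A c) ^ 2 := by
  refine le_antisymm ?_ ((memD_profile A hc).uncertainty (isToroidal_profile hA c))
  have henergy := energy_profile_eq_zero hA hc
  set g := gradInt (jac (profile A c))
  set M := momentInt (profile A c)
  set m := massInt (profile A c)
  refine le_of_mul_le_mul_left ?_ (show 0 < 16 * c ^ 2 by positivity)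
  calc 16 * c ^ 2 * (g * M) ≤ (g + 4 * c ^ 2 * M) ^ 2 := by
        linarith [sq_nonneg (g - 4 * c ^ 2 * M)]
    _ = (2 * c * (N + 2) * m) ^ 2 := by rw [sub_eq_zero.1 henergy]
    _ = 16 * c ^ 2 * (((N : ℝ) + 2) ^ 2 / 4 * m ^ 2) := by ring

theorem exists_transpose_eq_neg_ne_zero (n : Type*) [Nontrivial n] :
    ∃ A : Matrix n n ℝ, Aᵀ = -A ∧ A ≠ 0 := by
  classical
  obtain ⟨i, j, hij⟩ := exists_pair_ne n
  refine ⟨Matrix.single i j 1 - Matrix.single j i 1, ?_, fun h => ?_⟩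
  · rw [Matrix.transpose_sub, Matrix.transpose_single, Matrix.transpose_single, neg_sub]
  · have hentry := congrFun₂ h i j
    simp [hij, hij.symm] at hentry

end HUP

end

theorem theorem2_general (N : ℕ) (hN : 2 ≤ N) :
    (∀ (u : HUP.Sp N → HUP.Sp N) (G : HUP.Sp N → Matrix (Fin N) (Fin N) ℝ),
      HUP.MemD u G → HUP.IsToroidal u G →
        HUP.gradInt G * HUP.momentInt u ≥ ((N : ℝ) + 2) ^ 2 / 4 * HUP.massInt u ^ 2) ∧
    IsLeast {Q : ℝ | ∃ (u : HUP.Sp N → HUP.Sp N) (G : HUP.Sp N → Matrix (Fin N) (Fin N) ℝ),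
      HUP.MemD u G ∧ HUP.IsToroidal u G ∧ ¬ (u =ᵐ[volume] 0) ∧
        Q = HUP.gradInt G * HUP.momentInt u / HUP.massInt u ^ 2} (((N : ℝ) + 2) ^ 2 / 4) ∧
    (∀ (A : Matrix (Fin N) (Fin N) ℝ) (c : ℝ), Aᵀ = -A → 0 < c →
      ContDiff ℝ ∞ (HUP.profile A c) ∧
      HUP.MemD (HUP.profile A c) (HUP.jac (HUP.profile A c)) ∧
      HUP.IsToroidal (HUP.profile A c) (HUP.jac (HUP.profile A c)) ∧
      HUP.DecayCond (HUP.profile A c) ∧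
      (A ≠ 0 → ¬ (HUP.profile A c =ᵐ[volume] 0)) ∧
      HUP.gradInt (HUP.jac (HUP.profile A c)) * HUP.momentInt (HUP.profile A c)
        = ((N : ℝ) + 2) ^ 2 / 4 * HUP.massInt (HUP.profile A c) ^ 2) ∧
    (∀ (u : HUP.Sp N → HUP.Sp N) (G : HUP.Sp N → Matrix (Fin N) (Fin N) ℝ),
      HUP.MemD u G → HUP.IsToroidal u G → ¬ (u =ᵐ[volume] 0) →
      HUP.gradInt G * HUP.momentInt u = ((N : ℝ) + 2) ^ 2 / 4 * HUP.massInt u ^ 2 →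
        ∃ (A : Matrix (Fin N) (Fin N) ℝ) (c : ℝ), Aᵀ = -A ∧ 0 < c ∧
          u =ᵐ[volume] HUP.profile A c) := by
  refine ⟨fun u G h ht => h.uncertainty ht, ⟨?_, ?_⟩, fun A c hA hc =>
    ⟨HUP.contDiff_profile A c, HUP.memD_profile A hc, HUP.isToroidal_profile hA c,
      HUP.decayCond_profile A hc, fun hA0 => HUP.profile_not_ae_eq_zero hA0 c,
      HUP.uncertainty_eq_profile hA hc⟩,
    fun u G h ht hu heq => h.exists_profile_of_uncertainty_eq ht hu heq⟩
  · have : Nontrivial (Fin N) := Fin.nontrivial_iff_two_le.2 hN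
    obtain ⟨A, hA, hA0⟩ := HUP.exists_transpose_eq_neg_ne_zero (Fin N)
    have h := HUP.memD_profile A one_pos
    have hne := HUP.profile_not_ae_eq_zero hA0 1
    refine ⟨_, _, h, HUP.isToroidal_profile hA 1, hne, ?_⟩
    rw [HUP.uncertainty_eq_profile hA one_pos,
      mul_div_cancel_right₀ _ (pow_pos (h.massInt_pos hne) 2).ne']
  · rintro Q ⟨u, G, h, ht, hu, rfl⟩
    rw [le_div_iff₀ (pow_pos (h.massInt_pos hu) 2)]
    exact h.uncertainty ht

theorem theorem2 (N : ℕ) (hN : 2 ≤ N) :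
    (∀ (u : HUP.Sp N → HUP.Sp N) (G : HUP.Sp N → Matrix (Fin N) (Fin N) ℝ),
      HUP.MemD u G → HUP.IsToroidal u G →
        HUP.gradInt G * HUP.momentInt u ≥ ((N : ℝ) + 2) ^ 2 / 4 * HUP.massInt u ^ 2) ∧
    IsLeast {Q : ℝ | ∃ (u : HUP.Sp N → HUP.Sp N) (G : HUP.Sp N → Matrix (Fin N) (Fin N) ℝ),
      HUP.MemD u G ∧ HUP.IsToroidal u G ∧ ¬ (u =ᵐ[volume] 0) ∧
        Q = HUP.gradInt G * HUP.momentInt u / HUP.massInt u ^ 2} (((N : ℝ) + 2) ^ 2 / 4) ∧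
    (∀ (A : Matrix (Fin N) (Fin N) ℝ) (c : ℝ), Aᵀ = -A → 0 < c →
      ContDiff ℝ ∞ (HUP.profile A c) ∧
      HUP.MemD (HUP.profile A c) (HUP.jac (HUP.profile A c)) ∧
      HUP.IsToroidal (HUP.profile A c) (HUP.jac (HUP.profile A c)) ∧
      HUP.DecayCond (HUP.profile A c) ∧
      (A ≠ 0 → ¬ (HUP.profile A c =ᵐ[volume] 0)) ∧
      HUP.gradInt (HUP.jac (HUP.profile A c)) * HUP.momentInt (HUP.profile A c)
        = ((N : ℝ) + 2) ^ 2 / 4 * HUP.massInt (HUP.profile A c) ^ 2) ∧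
    (∀ (u : HUP.Sp N → HUP.Sp N) (G : HUP.Sp N → Matrix (Fin N) (Fin N) ℝ),
      HUP.MemD u G → HUP.IsToroidal u G → HUP.DecayCond u → ¬ (u =ᵐ[volume] 0) →
      HUP.gradInt G * HUP.momentInt u = ((N : ℝ) + 2) ^ 2 / 4 * HUP.massInt u ^ 2 →
        ∃ (A : Matrix (Fin N) (Fin N) ℝ) (c : ℝ), Aᵀ = -A ∧ 0 < c ∧
          u =ᵐ[volume] HUP.profile A c) := by
  obtain ⟨hineq, hleast, hextremal, hunique⟩ := theorem2_general N hN
  exact ⟨hineq, hleast, hextremal, fun u G h ht _ => hunique u G h ht⟩
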